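/- Let $k$ be a field and let $\phi:A\to B$ be a morphism of (associative, unital) $k$-algebras. Write $A^e=A\otimes_k A^{\mathrm{op}}$ and $B^e=B\otimes_k B^{\mathrm{op}}$, identify $B$-bimodules (with $k$ acting centrally) with left $B^e$-modules, and let $H^n(A,-)=\operatorname{Ext}^n_{A^e}(A,-)$ denote Hochschild cohomology. Regard $B$ as an $A$-module on either side through $\phi$; then $\operatorname{Tor}_q^A(B,B)$ is a $B$-bimodule, with left action coming from the first argument and right action from the second one. A $B$-bimodule $M$ is regarded as an $A$-bimodule by pull-back along $\phi$. Then there is a first quadrant cohomological spectral sequence of $k$-vector spaces, functorial in the $B$-bimodule $M$, $$E_2^{p,q}\cong\operatorname{Ext}^p_{B^e}\bigl(\operatorname{Tor}^A_q(B,B),M\bigr)\Rightarrow H^{p+q}(A,M),$$ with differentials $d_r^{p,q}:E_r^{p,q}\to E_r^{p+r,q-r+1}$, $r\ge 2$, in which the isomorphism is natural in $M$. It converges naturally in $M$: each $H^n(A,M)$ has a decreasing filtration $H^n(A,M)=F^0\supseteq F^1\supseteq\dots\supseteq F^{n+1}=0$, preserved by the maps induced by morphisms $M\to M'$, with $F^pH^{p+q}(A,M)/F^{p+1}H^{p+q}(A,M)\cong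 E_\infty^{p,q}$ naturally in $M$. Moreover, for each $q\ge1$ there is a class $\mathcal O_q(\phi)\in\operatorname{Ext}^2_{B^e}\bigl(\operatorname{Tor}^A_{q-1}(B,B),\operatorname{Tor}^A_q(B,B)\bigr)$, depending neither on $p$ nor on $M$, such that under the above isomorphisms the differential $$d_2^{p,q}:\operatorname{Ext}^p_{B^e}\bigl(\operatorname{Tor}^A_q(B,B),M\bigr)\to\operatorname{Ext}^{p+2}_{B^e}\bigl(\operatorname{Tor}^A_{q-1}(B,B),M\bigr)$$ is given by $d_2^{p,q}(\zeta)=(-1)^p\,\zeta\circ\mathcal O_q(\phi)$ for all $B$-bimodules $M$, all $p\ge0$ and all $\zeta\in\operatorname{Ext}^p_{B^e}(\operatorname{Tor}^A_q(B,B),M)$, where $\circ$ is the Yoneda product. -/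

import Mathlib

universe u

open CategoryTheory TensorProduct

namespace HochSS

section BaseChange

variable {R S : Type u} [Ring R] [Ring S] (f : R →+* S)

/-- The relations `s f(r) ⊗ m = s ⊗ r m` that define the balanced tensor product over `R`
(no commutativity is assumed). -/
def balancedRel (M : Type u) [AddCommGroup M] [Module R M] : Submodule S (S ⊗[ℤ] M) :=
  Submodule.span S {x | ∃ (s : S) (r : R) (m : M), x = (s * f r) ⊗ₜ[ℤ] m - s ⊗ₜ[ℤ] (r • m)}

/-- The left `S`-module `S ⊗_R M`, where `S` is a right `R`-module through `f : R → S`. -/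
abbrev BaseChange (M : Type u) [AddCommGroup M] [Module R M] : Type u :=
  (S ⊗[ℤ] M) ⧸ balancedRel f M

/-- The map `S ⊗_R M → S ⊗_R N` induced by an `R`-linear map `g : M → N`. -/
noncomputable def baseChangeMap {M N : Type u} [AddCommGroup M] [Module R M] [AddCommGroup N]
    [Module R N] (g : M →ₗ[R] N) : BaseChange f M →ₗ[S] BaseChange f N :=
  Submodule.mapQ _ _
    (AlgebraTensorModule.map (LinearMap.id : S →ₗ[S] S) g.toAddMonoidHom.toIntLinearMap) (by
      refine Submodule.span_le.2 ?_
      rintro _ ⟨s, r, m, rfl⟩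
      refine Submodule.subset_span ⟨s, r, g m, ?_⟩
      simp)

/-- The canonical element `s ⊗ m` of `S ⊗_R M`. -/
noncomputable def baseChangeMk {M : Type u} [AddCommGroup M] [Module R M] (s : S) (m : M) :
    BaseChange f M :=
  (balancedRel f M).mkQ (s ⊗ₜ[ℤ] m)

theorem baseChangeMk_balanced {M : Type u} [AddCommGroup M] [Module R M] (s : S) (r : R) (m : M) :
    baseChangeMk f (s * f r) m = baseChangeMk f s (r • m) :=
  (Submodule.Quotient.eq _).2 (Submodule.subset_span ⟨s, r, m, rfl⟩)

theorem smul_baseChangeMk {M : Type u} [AddCommGroup M] [Module R M] (t s : S) (m : M) :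
    t • baseChangeMk f s m = baseChangeMk f (t * s) m := rfl

theorem baseChangeMap_mk {M N : Type u} [AddCommGroup M] [Module R M] [AddCommGroup N]
    [Module R N] (g : M →ₗ[R] N) (s : S) (m : M) :
    baseChangeMap f g (baseChangeMk f s m) = baseChangeMk f s (g m) := rfl

theorem baseChange_hom_ext {M N : Type u} [AddCommGroup M] [Module R M] [AddCommGroup N]
    [Module S N] {g h : BaseChange f M →ₗ[S] N}
    (H : ∀ s m, g (baseChangeMk f s m) = h (baseChangeMk f s m)) : g = h := by
  refine Submodule.linearMap_qext _ (LinearMap.ext fun x => ?_)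
  induction x with
  | zero => simp
  | tmul s m => exact H s m
  | add x y hx hy => simp only [map_add, hx, hy]

/-- The functor `S ⊗_R -` from left `R`-modules to left `S`-modules. -/
noncomputable def baseChange : ModuleCat.{u} R ⥤ ModuleCat.{u} S where
  obj M := ModuleCat.of S (BaseChange f M)
  map g := ModuleCat.ofHom (baseChangeMap f g.hom)
  map_id M := ModuleCat.hom_ext (baseChange_hom_ext f fun s m => by simp [baseChangeMap_mk])
  map_comp g h := ModuleCat.hom_ext (baseChange_hom_ext f fun s m => by simp [baseChangeMap_mk])

instance : (baseChange f).Additive where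
  map_add {M N g h} := ModuleCat.hom_ext (baseChange_hom_ext f fun s m => by
    change (balancedRel f N).mkQ (s ⊗ₜ[ℤ] (g m + h m)) =
      (balancedRel f N).mkQ (s ⊗ₜ[ℤ] g m) + (balancedRel f N).mkQ (s ⊗ₜ[ℤ] h m)
    rw [TensorProduct.tmul_add, map_add])

/-- `Tor_n^R(S, -)`, with its left `S`-module structure: the left derived functors
of `S ⊗_R -`. -/
noncomputable def torFunctor (n : ℕ) : ModuleCat.{u} R ⥤ ModuleCat.{u} S :=
  (baseChange f).leftDerived n

end BaseChange

section Tor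

variable {k : Type u} [Field k] {A B : Type u} [Ring A] [Ring B] [Algebra k A] [Algebra k B]
  (φ : A →ₐ[k] B)

instance : (baseChange (φ : A →+* B)).Linear k where
  map_smul {M N} g c := ModuleCat.hom_ext (baseChange_hom_ext _ fun s m => by
    change baseChangeMk (φ : A →+* B) s (algebraMap k A c • g m) =
      algebraMap k B c • baseChangeMk (φ : A →+* B) s (g m)
    rw [← baseChangeMk_balanced, smul_baseChangeMk]
    simp [Algebra.commutes])

theorem torFunctor_map_smul_id (n : ℕ) (M : ModuleCat.{u} A) (c : k) :
    (torFunctor (φ : A →+* B) n).map (c • 𝟙 M) =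
      c • 𝟙 ((torFunctor (φ : A →+* B) n).obj M) := by
  let P := projectiveResolution M
  rw [torFunctor, Functor.leftDerived_map_eq _ n (c • 𝟙 M) (P := P) (Q := P) (c • 𝟙 _)
    (by
      rw [Linear.smul_comp, Category.id_comp]
      ext : 1
      simp only [HomologicalComplex.smul_f_apply, HomologicalComplex.comp_f,
        ChainComplex.single₀_map_f_zero]
      exact ((Linear.comp_smul _ _ _ (P.π.f 0) c (𝟙 M)).trans
        (congrArg (c • ·) (Category.comp_id _))).symm)]
  have : ((baseChange (φ : A →+* B)).mapHomologicalComplex (ComplexShape.down ℕ)).map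
      (c • 𝟙 P.complex) = c • 𝟙 _ := by
    ext1 i
    simp [Functor.map_smul]
  have h (K : ChainComplex (ModuleCat.{u} B) ℕ) :
      (HomologicalComplex.homologyFunctor (ModuleCat.{u} B) (ComplexShape.down ℕ) n).map
        (c • 𝟙 K) = c • 𝟙 _ := by
    rw [← CategoryTheory.Functor.map_id]
    exact ShortComplex.homologyMap_smul (S₁ := K.sc n) (S₂ := K.sc n) (𝟙 _) c
  rw [Functor.comp_map, this, h]
  rw [Linear.smul_comp, Linear.comp_smul, Category.id_comp, Iso.hom_inv_id]

instance (n : ℕ) : (torFunctor (φ : A →+* B) n).Additive where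
  map_add {M N g h} := by
    let P := projectiveResolution M
    let Q := projectiveResolution N
    rw [torFunctor, Functor.leftDerived_map_eq _ n (g + h) (P := P) (Q := Q)
        (ProjectiveResolution.lift g P Q + ProjectiveResolution.lift h P Q) (by simp),
      Functor.leftDerived_map_eq _ n g (P := P) (Q := Q) (ProjectiveResolution.lift g P Q)
        (by simp),
      Functor.leftDerived_map_eq _ n h (P := P) (Q := Q) (ProjectiveResolution.lift h P Q)
        (by simp)]
    rw [← Preadditive.comp_add, ← Preadditive.add_comp, ← Functor.map_add]

/-- `B` as a left `A`-module through `φ`. -/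
noncomputable abbrev leftModule : ModuleCat.{u} A :=
  (ModuleCat.restrictScalars (φ : A →+* B)).obj (ModuleCat.of B B)

/-- Right multiplication by `b`, an endomorphism of the left `A`-module `B`. -/
noncomputable def rightMul (b : B) : leftModule φ ⟶ leftModule φ :=
  (ModuleCat.restrictScalars (φ : A →+* B)).map
    (ModuleCat.ofHom (LinearMap.toSpanSingleton B B b))

theorem rightMul_apply (b x : B) : (rightMul φ b).hom x = x * b := rfl

/-- `Tor_q^A(B,B)`. -/
def Tor (q : ℕ) : Type u := (torFunctor (φ : A →+* B) q).obj (leftModule φ)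

noncomputable instance (q : ℕ) : AddCommGroup (Tor φ q) :=
  inferInstanceAs (AddCommGroup ((torFunctor (φ : A →+* B) q).obj (leftModule φ)))

/-- The left action of `B` on `Tor_q^A(B,B)`, coming from the first argument. -/
noncomputable instance (q : ℕ) : Module B (Tor φ q) :=
  inferInstanceAs (Module B ((torFunctor (φ : A →+* B) q).obj (leftModule φ)))

noncomputable instance (q : ℕ) : Module k (Tor φ q) :=
  Module.restrictScalars k B (Tor φ q)

instance (q : ℕ) : IsScalarTower k B (Tor φ q) :=
  IsScalarTower.restrictScalars k B (Tor φ q)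

/-- The endomorphism of `Tor_q^A(B,B)` induced by right multiplication by `b` on the second
argument. -/
noncomputable def torRightMul (q : ℕ) (b : B) : Tor φ q →ₗ[B] Tor φ q :=
  ((torFunctor (φ : A →+* B) q).map (rightMul φ b)).hom

theorem torRightMul_algebraMap (q : ℕ) (c : k) (x : Tor φ q) :
    torRightMul φ q (algebraMap k B c) x = c • x := by
  have h : rightMul φ (algebraMap k B c) = c • 𝟙 (leftModule φ) := by
    ext x
    change (show B from x) * algebraMap k B c = φ (algebraMap k A c) * (show B from x)
    rw [AlgHom.commutes, Algebra.commutes]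
  rw [torRightMul, h, torFunctor_map_smul_id]
  rfl

theorem torRightMul_add (q : ℕ) (b b' : B) :
    torRightMul φ q (b + b') = torRightMul φ q b + torRightMul φ q b' := by
  have h : rightMul φ (b + b') = rightMul φ b + rightMul φ b' := by
    ext x
    exact mul_add (show B from x) b b'
  rw [torRightMul, h, Functor.map_add]
  rfl

theorem torRightMul_mul (q : ℕ) (b b' : B) :
    torRightMul φ q (b * b') = torRightMul φ q b' ∘ₗ torRightMul φ q b := by
  have h : rightMul φ (b * b') = rightMul φ b ≫ rightMul φ b' := by
    ext x
    exact (mul_assoc (show B from x) b b').symm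
  rw [torRightMul, h, Functor.map_comp]
  rfl

theorem torRightMul_one (q : ℕ) : torRightMul φ q 1 = LinearMap.id := by
  ext x
  simpa using torRightMul_algebraMap φ q (1 : k) x

theorem torRightMul_zero (q : ℕ) : torRightMul φ q 0 = 0 := by
  ext x
  simpa using torRightMul_algebraMap φ q (0 : k) x

/-- The right action of `B` on `Tor_q^A(B,B)`, induced by functoriality from the right
multiplications on the second argument `B`. -/
noncomputable instance (q : ℕ) : Module Bᵐᵒᵖ (Tor φ q) where
  smul b x := torRightMul φ q b.unop x
  one_smul x := LinearMap.congr_fun (torRightMul_one φ q) x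
  mul_smul b b' x := LinearMap.congr_fun (torRightMul_mul φ q b'.unop b.unop) x
  smul_zero b := map_zero (torRightMul φ q b.unop)
  smul_add b x y := map_add (torRightMul φ q b.unop) x y
  add_smul b b' x := LinearMap.congr_fun (torRightMul_add φ q b.unop b'.unop) x
  zero_smul x := LinearMap.congr_fun (torRightMul_zero φ q) x

theorem op_smul_tor (q : ℕ) (b : B) (x : Tor φ q) :
    MulOpposite.op b • x = torRightMul φ q b x := rfl

instance (q : ℕ) : SMulCommClass B Bᵐᵒᵖ (Tor φ q) where
  smul_comm b b' x := (map_smul (torRightMul φ q b'.unop) b x).symm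

instance (q : ℕ) : IsScalarTower k Bᵐᵒᵖ (Tor φ q) where
  smul_assoc c b x := by
    induction b using MulOpposite.rec' with | _ b
    rw [← MulOpposite.op_smul, op_smul_tor, op_smul_tor, Algebra.smul_def, torRightMul_mul,
      LinearMap.comp_apply, torRightMul_algebraMap]
    rw [← algebraMap_smul B c x, map_smul, algebraMap_smul]

noncomputable instance (q : ℕ) : Module (B ⊗[k] Bᵐᵒᵖ) (Tor φ q) := TensorProduct.Algebra.module

/-- `Tor_q^A(B,B)` as a `B`-bimodule, that is, as a left module over `Bᵉ = B ⊗ Bᵒᵖ`. -/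
noncomputable def torBimodule (q : ℕ) : ModuleCat.{u} (B ⊗[k] Bᵐᵒᵖ) :=
  ModuleCat.of (B ⊗[k] Bᵐᵒᵖ) (Tor φ q)

end Tor

section Hochschild

/-- The functor `Ext^n(X, -)` with values in `k`-vector spaces. -/
noncomputable def extFunctor (k : Type u) [Field k] {R : Type u} [Ring R] [Algebra k R]
    (X : ModuleCat.{u} R) (n : ℕ) : ModuleCat.{u} R ⥤ ModuleCat.{u} k where
  obj Y := ModuleCat.of k (Abelian.Ext X Y n)
  map g := ModuleCat.ofHom ((Abelian.Ext.mk₀ g).postcompOfLinear k X (add_zero n))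
  map_id Y := by
    ext x
    simp [Abelian.Ext.bilinearCompOfLinear]
  map_comp g h := by
    ext x
    simp [Abelian.Ext.bilinearCompOfLinear, ← Abelian.Ext.mk₀_comp_mk₀]

variable (k : Type u) [Field k] (A : Type u) [Ring A] [Algebra k A]

/-- The regular bimodule `A`, with `(a ⊗ a') • x = a x a'`. -/
noncomputable def regularBimodule : ModuleCat.{u} (A ⊗[k] Aᵐᵒᵖ) :=
  letI := instModuleTensorProductMop k A
  ModuleCat.of (A ⊗[k] Aᵐᵒᵖ) A

/-- Hochschild cohomology `H^n(A, -) = Ext^n_{Aᵉ}(A, -)`. -/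
noncomputable def hochschildCohomology (n : ℕ) :
    ModuleCat.{u} (A ⊗[k] Aᵐᵒᵖ) ⥤ ModuleCat.{u} k :=
  extFunctor k (regularBimodule k A) n

variable {k A} {B : Type u} [Ring B] [Algebra k B] (φ : A →ₐ[k] B)

/-- The morphism `φ ⊗ φᵒᵖ : Aᵉ → Bᵉ`. -/
noncomputable def envelopingMap : A ⊗[k] Aᵐᵒᵖ →ₐ[k] B ⊗[k] Bᵐᵒᵖ :=
  Algebra.TensorProduct.map φ (AlgHom.op φ)

/-- A `B`-bimodule regarded as an `A`-bimodule by pull-back along `φ`. -/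
noncomputable def pullback : ModuleCat.{u} (B ⊗[k] Bᵐᵒᵖ) ⥤ ModuleCat.{u} (A ⊗[k] Aᵐᵒᵖ) :=
  ModuleCat.restrictScalars (envelopingMap φ : A ⊗[k] Aᵐᵒᵖ →+* B ⊗[k] Bᵐᵒᵖ)

end Hochschild

section Convergence

variable {k : Type u} [Field k]

/-- `E_∞^{p,q}` of a first quadrant spectral sequence. For `r ≥ max (p+1) (q+2)` the differentials
`d_r` that enter and leave position `(p,q)` vanish, so that `E_r^{p,q}` is the stable value. -/
noncomputable def eInfty (p q : ℕ) :
    E₂CohomologicalSpectralSequenceNat (ModuleCat.{u} k) ⥤ ModuleCat.{u} k :=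
  SpectralSequence.pageFunctor _ _ 2 (max (p + 1 : ℤ) (q + 2 : ℤ)) (by lia) ⋙
    HomologicalComplex.eval _ _ (p, q)

/-- Convergence `E_2^{p,q} ⇒ H^{p+q}` of first quadrant spectral sequences of vector spaces, for a
functorial family: natural finite decreasing filtrations of the `H^n`, with natural isomorphisms
`F^p H^{p+q} / F^{p+1} H^{p+q} ≅ E_∞^{p,q}`, given as surjections `F^p H^{p+q} → E_∞^{p,q}` with
kernel `F^{p+1} H^{p+q}`. -/
structure Convergence {D : Type*} [Category D]
    (E : D ⥤ E₂CohomologicalSpectralSequenceNat (ModuleCat.{u} k))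
    (H : ℕ → D ⥤ ModuleCat.{u} k) where
  /-- `F M n p` is `F^p H^n(M)`. -/
  F (M : D) (n p : ℕ) : Submodule k ((H n).obj M)
  F_antitone (M : D) (n : ℕ) : Antitone (F M n)
  F_zero (M : D) (n : ℕ) : F M n 0 = ⊤
  F_succ (M : D) (n : ℕ) : F M n (n + 1) = ⊥
  F_natural {M N : D} (g : M ⟶ N) (n p : ℕ) : F M n p ≤ (F N n p).comap ((H n).map g).hom
  /-- The projection `F^p H^{p+q} → E_∞^{p,q}`. -/
  π (M : D) (p q : ℕ) : F M (p + q) p →ₗ[k] (E ⋙ eInfty p q).obj M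
  π_surjective (M : D) (p q : ℕ) : Function.Surjective (π M p q)
  ker_π (M : D) (p q : ℕ) :
    LinearMap.ker (π M p q) = (F M (p + q) (p + 1)).comap (F M (p + q) p).subtype
  π_natural {M N : D} (g : M ⟶ N) (p q : ℕ) (x : F M (p + q) p) :
    ((E ⋙ eInfty p q).map g).hom (π M p q x) =
      π N p q ⟨((H (p + q)).map g).hom x, F_natural g (p + q) p x.2⟩

end Convergence

end HochSS

universe w

namespace HochSS

open Limits ComposableArrows

/-! Let P → A be a projective resolution over Aᵉ and let X = B ⊗_A P ⊗_A B in D(Bᵉ). The functor B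
⊗_A - ⊗_A B is left adjoint to the pull-back of bimodules. The pull-back is exact, so its left
adjoint preserves projectives, and Hom(X, M[n]) = Hom(A, M[n]) = Hⁿ(A, M) naturally in M
(`adjunctionHom_bijective`). Moreover H^{-q}(X) = Tor_q^A(B, B). Indeed A is projective as a right
A-module and, k being a field, so are the terms of P. Hence P → A is a homotopy equivalence of
complexes of right modules, and P ⊗_A B is a resolution of B by projective left A-modules, on which
B acts from the right (`nonempty_homology_envelopingExtension_iso`).

The spectral sequence is that of the canonical truncations of X. The pieces τ_{≥i} τ_{<j} X form a
spectral object of D(Bᵉ), and the cohomological functors Hom(-, M[n]) turn it into an abelian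
spectral object (`homSpectralObject`). Its second page is Hom(H^{-q}(X)[q], M[p+q]) = Ext^p(Tor_q,
M). It lies in the first quadrant because X has no cohomology in positive degrees and M sits in
degree 0. Convergence then follows from the long exact sequences (`exists_page_factorization`,
`spectralObjectConvergence`). All of this takes place in the category of functors of M, so
naturality in M is automatic.

The differential d₂ is precomposition with the connecting morphism H^{-q}(X)[q] → H^{-q-1}(X)[q+2]
of two consecutive pieces. That morphism is a class in Ext²(Tor_q, Tor_{q+1}), defined without
reference to p or M (`exists_iso_ext_and_differential`). The sign (-1)^p is produced by rescaling
the identifications of the second page.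

One technical point: morphisms in a derived category need not lie in universe `u`. The groups Hom(X,
M[n]) and their truncated versions are shown to be small and are replaced by `u`-small models. -/

lemma comp_comp_eq_of_squares {V : Type*} [Category* V]
    {X₁ X₂ X₃ Y₁ Y₂ Y₃ : V} {a : X₁ ⟶ X₂} {p : X₂ ⟶ Y₂} {q : X₁ ⟶ Y₁}
    {b : Y₁ ⟶ Y₂} {c : Y₂ ⟶ Y₃} {e : X₂ ⟶ X₃} {d : X₃ ⟶ Y₃} (h : a ≫ p = q ≫ b)
    (h' : p ≫ c = e ≫ d) : q ≫ b ≫ c = (a ≫ e) ≫ d := by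
  rw [← reassoc_of% h, h', Category.assoc]

/-! ### Evaluating a spectral sequence of functors. -/

section Evaluation


variable {T : Type u₁} [Category.{v₁} T] {V : Type u₂} [Category.{v₂} V] [Abelian V]
  {κ : Type*} {c : ℤ → ComplexShape κ} {r₀ : ℤ}

/-- The value at `t` of a spectral sequence in a category of functors. -/
noncomputable def spectralSequenceEval (E : SpectralSequence (T ⥤ V) c r₀) :
    T ⥤ SpectralSequence V c r₀ where
  obj t :=
    { page r hr := (((evaluation T V).obj t).mapHomologicalComplex (c r)).obj (E.page r)
      iso r r' pq hrr' hr := ((E.page r).sc pq).mapHomologyIso ((evaluation T V).obj t) ≪≫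
        ((evaluation T V).obj t).mapIso (E.iso r r' pq) }
  map {t t'} f :=
    { hom r hr := (NatTrans.mapHomologicalComplex ((evaluation T V).map f) (c r)).app (E.page r)
      comm r r' pq hrr' hr := by
        have h := NatTrans.app_homology ((evaluation T V).map f) ((E.page r).sc pq)
        rw [Iso.eq_inv_comp] at h
        exact comp_comp_eq_of_squares h ((E.iso r r' pq).hom.naturality f) }
  map_id t := by
    ext r hr i
    exact (E.page r).X i |>.map_id t
  map_comp f g := by
    ext r hr i
    exact (E.page r).X i |>.map_comp f g

end Evaluation
end HochSS

namespace HochSS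

open Limits ComposableArrows

/-! ### The limit page of a first quadrant spectral object. -/

section Limit

variable {C : Type*} [Category* C] [Abelian C] {ι : Type*} [Preorder ι]

/-- Over a preorder, any compatibility between the maps of a spectral object reduces to the
uniqueness of morphisms of arrows. -/
instance (i j : ComposableArrows ι 1) : Subsingleton (i ⟶ j) :=
  ⟨fun _ _ => NatTrans.ext (funext fun _ => Subsingleton.elim _ _)⟩

/-- The map `H^n(i ≤ j) ⟶ H^n(i' ≤ j')` of a spectral object indexed by a preorder. -/
abbrev spectralObjectMap (Y : Abelian.SpectralObject C ι) (n : ℤ) {i j i' j' : ι} (h : i ≤ j)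
    (h' : i' ≤ j') (hi : i ≤ i') (hj : j ≤ j') :
    (Y.H n).obj (mk₁ (homOfLE h)) ⟶ (Y.H n).obj (mk₁ (homOfLE h')) :=
  (Y.H n).map (homMk₁ (homOfLE hi) (homOfLE hj))

lemma spectralObjectMap_comp (Y : Abelian.SpectralObject C ι) (n : ℤ) {i j i' j' i'' j'' : ι}
    (h : i ≤ j) (h' : i' ≤ j') (h'' : i'' ≤ j'') (hi : i ≤ i') (hj : j ≤ j') (hi' : i' ≤ i'')
    (hj' : j' ≤ j'') :
    spectralObjectMap Y n h h' hi hj ≫ spectralObjectMap Y n h' h'' hi' hj' =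
      spectralObjectMap Y n h h'' (hi.trans hi') (hj.trans hj') := by
  rw [← Functor.map_comp]
  exact congrArg _ (Subsingleton.elim _ _)

variable (Y : Abelian.SpectralObject C EInt) [Y.IsFirstQuadrant]

/-- On the page `r ≥ max (p+1) (q+2)`, the object in position `(p,q)` is the image of the map
`H^{p+q}(⊥ ≤ q+1) ⟶ H^{p+q}(q ≤ ⊤)`. -/
theorem exists_page_factorization (p q : ℕ) (r : ℤ) (hr : 2 ≤ r) (hp : p + 1 ≤ r)
    (hq : q + 2 ≤ r) (n : ℤ) (hn : n = p + q) :
    ∃ (s : (Y.H n).obj (mk₁ (homOfLE (bot_le : ⊥ ≤ (((q : ℤ) + 1 : ℤ) : EInt)))) ⟶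
          (Y.E₂SpectralSequenceNat.page r).X (p, q))
      (j : (Y.E₂SpectralSequenceNat.page r).X (p, q) ⟶
          (Y.H n).obj (mk₁ (homOfLE (le_top : ((q : ℤ) : EInt) ≤ ⊤)))),
      Epi s ∧ Mono j ∧ s ≫ j = spectralObjectMap Y n _ _ bot_le le_top := by
  -- These are the four bounds defining E_r^{p,q}. The condition r ≥ q + 2 means i₀ ≤ 0, and r ≥ p +
  -- 1 means i₃ ≥ p + q = n.
  let i₀ : EInt := ((q - r + 2 : ℤ) : EInt)
  let i₁ : EInt := ((q : ℤ) : EInt)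
  let i₂ : EInt := ((q + 1 : ℤ) : EInt)
  let i₃ : EInt := ((q + r - 1 : ℤ) : EInt)
  have h₀₁ : i₀ ≤ i₁ := by simp [i₀, i₁]; lia
  have h₁₂ : i₁ ≤ i₂ := by simp [i₁, i₂]
  have h₂₃ : i₂ ≤ i₃ := by simp [i₂, i₃]; lia
  let e := Y.spectralSequencePageXIso Abelian.SpectralObject.coreE₂CohomologicalNat r hr (p, q)
    i₀ i₁ i₂ i₃ rfl rfl rfl rfl (n - 1) n (n + 1) hn
  let s₁ : (Y.H n).obj (mk₁ (homOfLE (bot_le : ⊥ ≤ i₂))) ⟶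
      (Y.H n).obj (mk₁ (homOfLE (h₀₁.trans h₁₂))) := spectralObjectMap Y n _ _ bot_le le_rfl
  let j₁ : (Y.H n).obj (mk₁ (homOfLE (h₁₂.trans h₂₃))) ⟶
      (Y.H n).obj (mk₁ (homOfLE (le_top : i₁ ≤ ⊤))) := spectralObjectMap Y n _ _ le_rfl le_top
  -- The obstruction to surjectivity lies in H^{n+1}(⊥ ≤ i₀), which vanishes as i₀ ≤ 0.
  have hs₁ : Epi s₁ := by
    have := Y.epi_H_map_twoδ₁Toδ₀' n (n + 1) rfl ⊥ i₀ i₂ bot_le (h₀₁.trans h₁₂)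
      (Y.isZero₁_of_isFirstQuadrant _ _ _ (by simp [i₀]; lia) _)
    rwa [show s₁ = (Y.H n).map (twoδ₁Toδ₀' ⊥ i₀ i₂ _ _) from
      congrArg _ (Subsingleton.elim _ _)]
  -- The kernel is the image of H^{n-1}(i₃ ≤ ⊤), which vanishes as n - 1 < i₃.
  have hj₁ : Mono j₁ := by
    have hz : Mono ((Y.H n).map (twoδ₂Toδ₁ (homOfLE (h₁₂.trans h₂₃))
        (homOfLE (le_top : i₃ ≤ ⊤)) (homOfLE le_top) (Subsingleton.elim _ _))) :=
      (Y.exact₁ (homOfLE (h₁₂.trans h₂₃)) (homOfLE (le_top : i₃ ≤ ⊤)) (homOfLE le_top)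
      (Subsingleton.elim _ _) (n - 1) n).mono_g
        ((Y.isZero₂_of_isFirstQuadrant _ _ _ _ (by simp [i₃]; lia)).eq_of_src _ _)
    rwa [show j₁ = _ from congrArg (Y.H n).map (Subsingleton.elim _ _)]
  let f₁ := homOfLE h₀₁
  let f₂ := homOfLE h₁₂
  let f₃ := homOfLE h₂₃
  -- E_r^{p,q} is the image of H^n(i₀ ≤ i₂) → H^n(i₁ ≤ i₃); composing with the epimorphism s₁ and
  -- the monomorphism j₁ does not change the image.
  refine ⟨s₁ ≫ Y.toCycles f₁ f₂ (homOfLE (h₀₁.trans h₁₂)) rfl n ≫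
    Y.πE f₁ f₂ f₃ (n - 1) n (n + 1) ≫ e.inv,
    e.hom ≫ Y.ιE f₁ f₂ f₃ (n - 1) n (n + 1) ≫
      Y.fromOpcycles f₂ f₃ (homOfLE (h₁₂.trans h₂₃)) rfl n ≫ j₁, ?_, ?_, ?_⟩
  · infer_instance
  · infer_instance
  · simp only [Category.assoc, Iso.inv_hom_id_assoc]
    rw [Y.πE_ιE_assoc f₁ f₂ f₃ .., Y.p_fromOpcycles_assoc, Y.toCycles_i_assoc]
    simp only [s₁, j₁, ← Functor.map_comp]
    exact congrArg _ (Subsingleton.elim _ _)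

end Limit

end HochSS

namespace HochSS

open Limits ComposableArrows

/-! ### Filtration of the abutment and convergence. -/

section AbstractConvergence

variable {k : Type u} [Field k] {T : Type*} [Category* T]
  (Y : Abelian.SpectralObject (T ⥤ ModuleCat.{u} k) EInt) [Y.IsFirstQuadrant]

omit [Field k] in
lemma natTrans_app_congr [Ring k] {F G : T ⥤ ModuleCat.{u} k} {f g : F ⟶ G} (h : f = g) (M : T)
    (x : F.obj M) : (f.app M).hom x = (g.app M).hom x := by
  rw [h]

/-- The restriction map `H^n(⊥ ≤ ⊤) ⟶ H^n(m ≤ ⊤)`. -/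
noncomputable abbrev restrictionMap (n m : ℤ) :
    (Y.H n).obj (mk₁ (homOfLE (bot_le : (⊥ : EInt) ≤ ⊤))) ⟶
      (Y.H n).obj (mk₁ (homOfLE (le_top : ((m : ℤ) : EInt) ≤ ⊤))) :=
  spectralObjectMap Y n _ _ bot_le le_rfl

omit [Y.IsFirstQuadrant] in
lemma restrictionMap_app_eq_zero_of_le (n : ℤ) {m m' : ℤ} (h : m ≤ m') (M : T)
    (x : ((Y.H n).obj (mk₁ (homOfLE (bot_le : (⊥ : EInt) ≤ ⊤)))).obj M)
    (hx : ((restrictionMap Y n m).app M).hom x = 0) :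
    ((restrictionMap Y n m').app M).hom x = 0 := by
  have := spectralObjectMap_comp Y n (bot_le : (⊥ : EInt) ≤ ⊤) (le_top : ((m : ℤ) : EInt) ≤ ⊤)
    (le_top : ((m' : ℤ) : EInt) ≤ ⊤) bot_le le_rfl (by simpa using h) le_rfl
  rw [restrictionMap, ← this, NatTrans.comp_app, ModuleCat.hom_comp, LinearMap.comp_apply, hx,
    map_zero]

/-- The kernel comes from H^n(⊥ ≤ 0), which is zero in the first quadrant. -/
lemma restrictionMap_app_injective (n : ℤ) (M : T) :
    Function.Injective ((restrictionMap Y n 0).app M).hom := by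
  have := Y.mono_H_map_twoδ₁Toδ₀' n ⊥ ((0 : ℤ) : EInt) ⊤ bot_le le_top
      (Y.isZero₁_of_isFirstQuadrant _ _ _ le_rfl _)
  have : Mono (restrictionMap Y n 0) := by
    rwa [show restrictionMap Y n 0 = _ from congrArg (Y.H n).map (Subsingleton.elim _ _)]
  exact (ModuleCat.mono_iff_injective _).1 inferInstance

omit [Y.IsFirstQuadrant] in
lemma restrictionMap_app_eq_zero_iff (n m : ℤ) (M : T)
    (x : ((Y.H n).obj (mk₁ (homOfLE (bot_le : (⊥ : EInt) ≤ ⊤)))).obj M) :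
    ((restrictionMap Y n m).app M).hom x = 0 ↔
      ∃ y, ((spectralObjectMap Y n (bot_le : (⊥ : EInt) ≤ ((m : ℤ) : EInt)) bot_le
        le_rfl le_top).app M).hom y = x := by
  have h := (Y.exact₂ (homOfLE (bot_le : (⊥ : EInt) ≤ ((m : ℤ) : EInt)))
    (homOfLE (le_top : ((m : ℤ) : EInt) ≤ ⊤)) (homOfLE bot_le) (Subsingleton.elim _ _) n).map
      ((evaluation T (ModuleCat.{u} k)).obj M)
  rw [ShortComplex.ShortExact.moduleCat_exact_iff_function_exact] at h
  exact h x

variable {H : ℕ → T ⥤ ModuleCat.{u} k}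
  (a : ∀ n : ℕ, H n ≅ (Y.H n).obj (mk₁ (homOfLE (bot_le : (⊥ : EInt) ≤ ⊤))))

/-- The filtration on the abutment of the spectral sequence of a spectral object. -/
noncomputable def abutmentFiltration (M : T) (n p : ℕ) : Submodule k ((H n).obj M) :=
  LinearMap.ker (((a n).hom ≫ restrictionMap Y n ((n : ℤ) - p + 1)).app M).hom

omit [Y.IsFirstQuadrant] in
lemma mem_abutmentFiltration_iff {M : T} {n p : ℕ} {m : ℤ} (hm : m = (n : ℤ) - p + 1)
    (x : (H n).obj M) :
    x ∈ abutmentFiltration Y a M n p ↔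
      ((restrictionMap Y n m).app M).hom (((a n).hom.app M).hom x) = 0 := by
  subst hm
  rfl

/-- The embedding of `E_∞^{p,q}` in `H^{p+q}(q ≤ ⊤)`. -/
noncomputable def eInftyEmbedding (p q : ℕ) :
    (Y.E₂SpectralSequenceNat.page (max (p + 1 : ℤ) (q + 2 : ℤ)) (by lia)).X (p, q) ⟶
      (Y.H (p + q : ℕ)).obj (mk₁ (homOfLE (le_top : ((q : ℤ) : EInt) ≤ ⊤))) :=
  (exists_page_factorization Y p q (max (p + 1 : ℤ) (q + 2 : ℤ)) (by lia) (by lia) (by lia)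
    (p + q : ℕ) (by simp)).choose_spec.choose

/-- The projection of `H^{p+q}(⊥ ≤ q+1)` to `E_∞^{p,q}`. -/
noncomputable def eInftyProjection (p q : ℕ) :
    (Y.H (p + q : ℕ)).obj (mk₁ (homOfLE (bot_le : ⊥ ≤ (((q : ℤ) + 1 : ℤ) : EInt)))) ⟶
      (Y.E₂SpectralSequenceNat.page (max (p + 1 : ℤ) (q + 2 : ℤ)) (by lia)).X (p, q) :=
  (exists_page_factorization Y p q (max (p + 1 : ℤ) (q + 2 : ℤ)) (by lia) (by lia) (by lia)
    (p + q : ℕ) (by simp)).choose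

lemma eInftyEmbedding_app_injective (p q : ℕ) (M : T) :
    Function.Injective ((eInftyEmbedding Y p q).app M).hom := by
  have : Mono (eInftyEmbedding Y p q) := (exists_page_factorization Y p q _ (by lia) (by lia)
    (by lia) (p + q : ℕ) (by simp)).choose_spec.choose_spec.2.1
  exact (ModuleCat.mono_iff_injective _).1 inferInstance

lemma eInftyProjection_app_surjective (p q : ℕ) (M : T) :
    Function.Surjective ((eInftyProjection Y p q).app M).hom := by
  have : Epi (eInftyProjection Y p q) := (exists_page_factorization Y p q _ (by lia) (by lia)
    (by lia) (p + q : ℕ) (by simp)).choose_spec.choose_spec.1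
  exact (ModuleCat.epi_iff_surjective _).1 inferInstance

lemma eInftyEmbedding_eInftyProjection (p q : ℕ) (M : T) (y) :
    ((eInftyEmbedding Y p q).app M).hom (((eInftyProjection Y p q).app M).hom y) =
      ((restrictionMap Y (p + q : ℕ) q).app M).hom
        (((spectralObjectMap Y (p + q : ℕ) (bot_le : (⊥ : EInt) ≤ (((q : ℤ) + 1 : ℤ) : EInt))
          bot_le le_rfl le_top).app M).hom y) := by
  have h : eInftyProjection Y p q ≫ eInftyEmbedding Y p q = _ :=
    (exists_page_factorization Y p q _ (by lia) (by lia)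
    (by lia) (p + q : ℕ) (by simp)).choose_spec.choose_spec.2.2
  have h' := spectralObjectMap_comp Y (p + q : ℕ)
    (bot_le : (⊥ : EInt) ≤ (((q : ℤ) + 1 : ℤ) : EInt))
    (bot_le : (⊥ : EInt) ≤ ⊤) (le_top : ((q : ℤ) : EInt) ≤ ⊤) le_rfl le_top bot_le le_rfl
  exact natTrans_app_congr (h.trans h'.symm) M y

/-- An element of F^p comes from H^{p+q}(⊥ ≤ q+1), and the map from there to H^{p+q}(q ≤ ⊤) factors
through E_∞^{p,q}. -/
lemma exists_eInftyEmbedding_eq {M : T} {p q : ℕ} {x : (H (p + q)).obj M}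
    (hx : x ∈ abutmentFiltration Y a M (p + q) p) :
    ((restrictionMap Y (p + q : ℕ) q).app M).hom (((a (p + q)).hom.app M).hom x) ∈
      LinearMap.range ((eInftyEmbedding Y p q).app M).hom := by
  rw [mem_abutmentFiltration_iff Y a (m := q + 1) (by simp),
    restrictionMap_app_eq_zero_iff] at hx
  obtain ⟨y, hy⟩ := hx
  exact ⟨((eInftyProjection Y p q).app M).hom y, by
    rw [eInftyEmbedding_eInftyProjection, hy]⟩

/-- The projection of the `p`-th step of the filtration to `E_∞^{p,q}`. -/
noncomputable def abutmentProjection (M : T) (p q : ℕ) :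
    abutmentFiltration Y a M (p + q) p →ₗ[k]
      (spectralSequenceEval Y.E₂SpectralSequenceNat ⋙ eInfty p q).obj M :=
  (LinearEquiv.ofInjective _ (eInftyEmbedding_app_injective Y p q M)).symm.toLinearMap ∘ₗ
    LinearMap.codRestrict _ (((restrictionMap Y (p + q : ℕ) q).app M).hom ∘ₗ
      ((a (p + q)).hom.app M).hom ∘ₗ (abutmentFiltration Y a M (p + q) p).subtype)
      (fun x => exists_eInftyEmbedding_eq Y a x.2)

lemma eInftyEmbedding_abutmentProjection (M : T) (p q : ℕ)
    (x : abutmentFiltration Y a M (p + q) p) :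
    ((eInftyEmbedding Y p q).app M).hom (abutmentProjection Y a M p q x) =
      ((restrictionMap Y (p + q : ℕ) q).app M).hom (((a (p + q)).hom.app M).hom x) :=
  congrArg Subtype.val (LinearEquiv.apply_symm_apply
    (LinearEquiv.ofInjective _ (eInftyEmbedding_app_injective Y p q M))
    ⟨_, exists_eInftyEmbedding_eq Y a x.2⟩)

/-- The spectral sequence of a first quadrant spectral object converges to `H^n(⊥ ≤ ⊤)`. -/
noncomputable def spectralObjectConvergence :
    Convergence (spectralSequenceEval Y.E₂SpectralSequenceNat) H where
  F := abutmentFiltration Y a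
  F_antitone M n p p' h x hx :=
    (mem_abutmentFiltration_iff Y a rfl x).2 (restrictionMap_app_eq_zero_of_le Y n (by lia) M _
      ((mem_abutmentFiltration_iff Y a rfl x).1 hx))
  F_zero M n := by
    rw [eq_top_iff]
    intro x _
    rw [mem_abutmentFiltration_iff Y a rfl]
    -- For p = 0 the target is H^n(n+1 ≤ ⊤) = 0.
    have : restrictionMap Y n ((n : ℤ) - (0 : ℕ) + 1) = 0 :=
      (Y.isZero₂_of_isFirstQuadrant _ _ _ _ (by simp)).eq_of_tgt _ _
    rw [this]
    rfl
  F_succ M n := by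
    rw [eq_bot_iff]
    intro x hx
    -- For p = n + 1 the bound n - p + 1 is 0, where restriction is injective.
    rw [mem_abutmentFiltration_iff Y a (m := 0) (by simp)] at hx
    have := restrictionMap_app_injective Y n M (hx.trans (map_zero _).symm)
    have h := congrArg ((a n).inv.app M).hom this
    rw [map_zero] at h
    exact (natTrans_app_congr (a n).hom_inv_id M x).symm.trans h
  F_natural {M N} g n p x hx := by
    rw [Submodule.mem_comap, mem_abutmentFiltration_iff Y a rfl]
    rw [mem_abutmentFiltration_iff Y a rfl] at hx
    have := congrArg (fun f => f.hom x)
      (((a n).hom ≫ restrictionMap Y n ((n : ℤ) - p + 1)).naturality g)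
    refine this.trans ?_
    exact (congrArg (((Y.H n).obj _).map g).hom hx).trans (map_zero (((Y.H n).obj _).map g).hom)
  π := abutmentProjection Y a
  π_surjective M p q e := by
    obtain ⟨y, rfl⟩ := eInftyProjection_app_surjective Y p q M e
    let z := ((spectralObjectMap Y (p + q : ℕ) (bot_le : (⊥ : EInt) ≤ (((q : ℤ) + 1 : ℤ) : EInt))
          bot_le le_rfl le_top).app M).hom y
    have hz : ((a (p + q)).hom.app M).hom (((a (p + q)).inv.app M).hom z) = z :=
      natTrans_app_congr (a (p + q)).inv_hom_id M z
    refine ⟨⟨((a (p + q)).inv.app M).hom z, ?_⟩, ?_⟩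
    · rw [mem_abutmentFiltration_iff Y a (m := q + 1) (by simp), hz,
        restrictionMap_app_eq_zero_iff]
      exact ⟨y, rfl⟩
    · apply eInftyEmbedding_app_injective Y p q M
      rw [eInftyEmbedding_abutmentProjection, eInftyEmbedding_eInftyProjection, hz]
  ker_π M p q := by
    ext x
    -- In degree p + q the bound for F^{p+1} is q, so F^{p+1} is the kernel of the very restriction
    -- map from which the projection is made.
    rw [LinearMap.mem_ker, Submodule.mem_comap,
      mem_abutmentFiltration_iff Y a (m := q) (by push_cast; ring)]
    have h := (eInftyEmbedding_app_injective Y p q M).eq_iff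
      (a := abutmentProjection Y a M p q x) (b := 0)
    rw [eInftyEmbedding_abutmentProjection, map_zero] at h
    exact h.symm
  π_natural {M N} g p q x := by
    apply eInftyEmbedding_app_injective Y p q N
    rw [eInftyEmbedding_abutmentProjection]
    have h₁ := congrArg (fun f => f.hom (abutmentProjection Y a M p q x))
      ((eInftyEmbedding Y p q).naturality g)
    have h₂ := congrArg (fun f => f.hom x.1)
      (((a (p + q)).hom ≫ restrictionMap Y (p + q : ℕ) q).naturality g)
    refine h₁.trans (Eq.trans ?_ h₂.symm)
    exact congrArg _ (eInftyEmbedding_abutmentProjection Y a M p q x)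

lemma two_le_two : (2 : ℤ) ≤ 2 := le_rfl

/-- The `E₂` page of the spectral sequence of a spectral object. -/
noncomputable def spectralObjectE₂Iso (p q : ℕ) (n : ℤ) (hn : n = p + q) :
    spectralSequenceEval Y.E₂SpectralSequenceNat ⋙ SpectralSequence.pageFunctor _ _ 2 2 two_le_two ⋙
        HomologicalComplex.eval _ _ (p, q) ≅
      (Y.H n).obj (mk₁ (homOfLE (by simp : ((q : ℤ) : EInt) ≤ ((q + 1 : ℤ) : EInt)))) :=
  NatIso.ofComponents (fun _ => Iso.refl _) ≪≫
    Y.spectralSequenceFirstPageXIso Abelian.SpectralObject.coreE₂CohomologicalNat (p, q) _ _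
      rfl rfl n hn

lemma spectralObjectE₂Iso_d (p q : ℕ) (n n' : ℤ) (hn : n = p + (q + 1 : ℕ))
    (hn' : n' = (p + 2 : ℕ) + q) (h : n + 1 = n') (M : T) (y) :
    ((spectralObjectE₂Iso Y (p + 2) q n' hn').hom.app M).hom
      (((((spectralSequenceEval Y.E₂SpectralSequenceNat).obj M).page 2 two_le_two).d
        (p, q + 1) (p + 2, q)).hom y) =
      ((Y.δ (homOfLE (by simp)) (homOfLE (by simp)) n n' h).app M).hom
        (((spectralObjectE₂Iso Y p (q + 1) n hn).hom.app M).hom y) := by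
  have := Y.spectralSequence_first_page_d_eq Abelian.SpectralObject.coreE₂CohomologicalNat
    (p, q + 1) (p + 2, q) (by simp) _ _ _ rfl rfl rfl n n' hn h
  rw [← Category.assoc, Iso.eq_comp_inv] at this
  exact natTrans_app_congr this M y

end AbstractConvergence

end HochSS

namespace HochSS

open Limits ComposableArrows

/-! ### Exactness in functor categories and small models. -/

section FunctorExactness

variable {k : Type u} [Ring k] {T : Type*} [Category* T] {F G H : T ⥤ ModuleCat.{u} k}

/-- Evaluation functors commute with homology, so exactness can be tested objectwise. -/
lemma composableArrows_exact_of_function_exact (f : F ⟶ G) (g : G ⟶ H)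
    (h : ∀ M, Function.Exact (f.app M).hom (g.app M).hom) : (mk₂ f g).Exact := by
  have w : f ≫ g = 0 := by
    ext M x
    exact (h M).apply_apply_eq_zero x
  have : (ShortComplex.mk f g w).Exact := by
    rw [ShortComplex.exact_iff_isZero_homology, Functor.isZero_iff]
    intro M
    refine IsZero.of_iso ?_ ((ShortComplex.mk f g w).mapHomologyIso
      ((evaluation T (ModuleCat.{u} k)).obj M)).symm
    rw [← ShortComplex.exact_iff_isZero_homology,
      ShortComplex.ShortExact.moduleCat_exact_iff_function_exact]
    exact h M
  exact this.exact_toComposableArrows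

end FunctorExactness

section ShrinkMap

variable {k : Type*} [Ring k] {V W Z : Type*} [AddCommGroup V] [Module k V] [AddCommGroup W]
  [Module k W] [AddCommGroup Z] [Module k Z] [Small.{u} V] [Small.{u} W] [Small.{u} Z]

/-- The map between shrunk modules induced by a linear map. -/
noncomputable def shrinkMap (f : V →ₗ[k] W) : Shrink.{u} V →ₗ[k] Shrink.{u} W :=
  (Shrink.linearEquiv k W).symm.toLinearMap ∘ₗ f ∘ₗ (Shrink.linearEquiv k V).toLinearMap

lemma shrinkMap_apply (f : V →ₗ[k] W) (x : V) :
    shrinkMap.{u} f ((Shrink.linearEquiv k V).symm x) = (Shrink.linearEquiv k W).symm (f x) := by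
  simp [shrinkMap]

lemma shrinkMap_id : shrinkMap.{u} (LinearMap.id : V →ₗ[k] V) = LinearMap.id := by
  ext x
  simp [shrinkMap]

lemma shrinkMap_comp (f : V →ₗ[k] W) (g : W →ₗ[k] Z) :
    shrinkMap.{u} (g ∘ₗ f) = shrinkMap.{u} g ∘ₗ shrinkMap.{u} f := by
  ext x
  simp [shrinkMap]

lemma shrinkMap_comp_congr {W' : Type*} [AddCommGroup W'] [Module k W'] [Small.{u} W']
    {f : V →ₗ[k] W} {g : W →ₗ[k] Z} {f' : V →ₗ[k] W'} {g' : W' →ₗ[k] Z}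
    (h : ∀ x, g (f x) = g' (f' x)) :
    shrinkMap.{u} g ∘ₗ shrinkMap.{u} f = shrinkMap.{u} g' ∘ₗ shrinkMap.{u} f' := by
  rw [← shrinkMap_comp, ← shrinkMap_comp]
  exact congrArg _ (LinearMap.ext h)

lemma shrinkMap_exact {f : V →ₗ[k] W} {g : W →ₗ[k] Z} (h : Function.Exact f g) :
    Function.Exact (shrinkMap.{u} f) (shrinkMap.{u} g) := by
  intro y
  obtain ⟨y, rfl⟩ := (Shrink.linearEquiv.{u} k W).symm.surjective y
  rw [shrinkMap_apply, LinearEquiv.map_eq_zero_iff, h y]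
  constructor
  · rintro ⟨x, rfl⟩
    exact ⟨(Shrink.linearEquiv k V).symm x, shrinkMap_apply _ _⟩
  · rintro ⟨x, hx⟩
    obtain ⟨x, rfl⟩ := (Shrink.linearEquiv.{u} k V).symm.surjective x
    rw [shrinkMap_apply] at hx
    exact ⟨x, (Shrink.linearEquiv.{u} k W).symm.injective hx⟩

end ShrinkMap

/-! ### The functors Hom(X, S(M)[n]) of M. -/

section HomFunctor

variable {k : Type u} [Field k] {D : Type*} [Category* D] [Preadditive D] [Linear k D]
  [HasShift D ℤ] [∀ n : ℤ, (shiftFunctor D n).Additive] [∀ n : ℤ, (shiftFunctor D n).Linear k]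
  {T : Type*} [Category* T] (S : T ⥤ D)

variable (k) in
/-- Precomposition with a shifted morphism, as a linear map. -/
@[simps]
noncomputable def shiftedHomLeftComp {X Y : D} (Z : D) {a n m : ℤ} (f : ShiftedHom X Y a)
    (h : n + a = m) : (Y ⟶ Z⟦n⟧) →ₗ[k] (X ⟶ Z⟦m⟧) where
  toFun x := f.comp x h
  map_add' x y := ShiftedHom.comp_add f x y h
  map_smul' c x := ShiftedHom.comp_smul c f x h

/-- The shifted morphisms from `X` to the objects in the image of `S` form `u`-small types. -/
class HomSmall (X : D) : Prop where
  small (M : T) (n : ℤ) : Small.{u} (X ⟶ (S.obj M)⟦n⟧)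

instance (X : D) [HomSmall.{u} S X] (M : T) (n : ℤ) : Small.{u} (X ⟶ (S.obj M)⟦n⟧) :=
  HomSmall.small M n

variable (k) in
/-- The functor `M ↦ Hom(X, S(M)[n])` to vector spaces. -/
noncomputable def shrinkHom (X : D) [HomSmall.{u} S X] (n : ℤ) : T ⥤ ModuleCat.{u} k where
  obj M := ModuleCat.of k (Shrink.{u} (X ⟶ (S.obj M)⟦n⟧))
  map g := ModuleCat.ofHom (shrinkMap (Linear.rightComp k X ((S.map g)⟦n⟧')))
  map_id M := ModuleCat.hom_ext (by
    change shrinkMap _ = LinearMap.id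
    rw [← shrinkMap_id]
    congr 1
    ext x
    simp)
  map_comp g h := ModuleCat.hom_ext (by
    change shrinkMap _ = shrinkMap _ ∘ₗ shrinkMap _
    rw [← shrinkMap_comp]
    congr 1
    ext x
    simp)

variable (k) in
/-- The linear identification of the values of `shrinkHom`. -/
noncomputable def shrinkHomEquiv (X : D) [HomSmall.{u} S X] (n : ℤ) (M : T) :
    (shrinkHom k S X n).obj M ≃ₗ[k] (X ⟶ (S.obj M)⟦n⟧) :=
  Shrink.linearEquiv.{u} k (X ⟶ (S.obj M)⟦n⟧)

omit [∀ n : ℤ, (shiftFunctor D n).Additive] [∀ n : ℤ, (shiftFunctor D n).Linear k] in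
lemma shrinkHom_map_apply (X : D) [HomSmall.{u} S X] (n : ℤ) {M N : T} (g : M ⟶ N)
    (x : X ⟶ (S.obj M)⟦n⟧) :
    ((shrinkHom k S X n).map g).hom ((shrinkHomEquiv k S X n M).symm x) =
      (shrinkHomEquiv k S X n N).symm (x ≫ (S.map g)⟦n⟧') :=
  shrinkMap_apply (Linear.rightComp k X ((S.map g)⟦n⟧')) x

section Precomp

variable {X Y : D} [HomSmall.{u} S X] [HomSmall.{u} S Y]

variable (k) in
/-- The natural transformation given by precomposition with a morphism. -/
noncomputable def shrinkHomMap (f : X ⟶ Y) (n : ℤ) : shrinkHom k S Y n ⟶ shrinkHom k S X n where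
  app M := ModuleCat.ofHom (shrinkMap (Linear.leftComp k _ f))
  naturality M N g := ModuleCat.hom_ext (by
    change shrinkMap _ ∘ₗ shrinkMap _ = shrinkMap _ ∘ₗ shrinkMap _
    exact shrinkMap_comp_congr fun x => by simp)

omit [∀ n : ℤ, (shiftFunctor D n).Additive] [∀ n : ℤ, (shiftFunctor D n).Linear k] in
lemma shrinkHomMap_app_apply (f : X ⟶ Y) (n : ℤ) (M : T) (x : Y ⟶ (S.obj M)⟦n⟧) :
    ((shrinkHomMap k S f n).app M).hom ((shrinkHomEquiv k S Y n M).symm x) =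
      (shrinkHomEquiv k S X n M).symm (f ≫ x) :=
  shrinkMap_apply (Linear.leftComp k _ f) x

omit [∀ n : ℤ, (shiftFunctor D n).Additive] [∀ n : ℤ, (shiftFunctor D n).Linear k] in
lemma shrinkHomMap_id (n : ℤ) : shrinkHomMap k S (𝟙 X) n = 𝟙 _ := by
  ext M x
  obtain ⟨x, rfl⟩ := (shrinkHomEquiv k S X n M).symm.surjective x
  rw [shrinkHomMap_app_apply]
  simp

omit [∀ n : ℤ, (shiftFunctor D n).Additive] [∀ n : ℤ, (shiftFunctor D n).Linear k] in
lemma shrinkHomMap_comp {Z : D} [HomSmall.{u} S Z] (f : X ⟶ Y) (g : Y ⟶ Z) (n : ℤ) :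
    shrinkHomMap k S (f ≫ g) n = shrinkHomMap k S g n ≫ shrinkHomMap k S f n := by
  ext M x
  obtain ⟨x, rfl⟩ := (shrinkHomEquiv k S Z n M).symm.surjective x
  simp [shrinkHomMap_app_apply]

variable (k) in
/-- The natural transformation given by precomposition with a morphism of degree one. -/
noncomputable def shrinkHomδ (f : ShiftedHom X Y (1 : ℤ)) (n₀ n₁ : ℤ) (h : n₀ + 1 = n₁) :
    shrinkHom k S Y n₀ ⟶ shrinkHom k S X n₁ where
  app M := ModuleCat.ofHom (shrinkMap (shiftedHomLeftComp k (S.obj M) f h))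
  naturality M N g := ModuleCat.hom_ext (by
    change shrinkMap _ ∘ₗ shrinkMap _ = shrinkMap _ ∘ₗ shrinkMap _
    refine shrinkMap_comp_congr fun x => ?_
    have := (shiftFunctorAdd' D n₀ 1 n₁ h).inv.naturality (S.map g)
    dsimp at this
    simp [ShiftedHom.comp, this])

omit [∀ n : ℤ, (shiftFunctor D n).Additive] [∀ n : ℤ, (shiftFunctor D n).Linear k] in
variable {S} in
lemma shrinkHomMap_exact {Z : D} [HomSmall.{u} S Z] {f : X ⟶ Y} {g : Y ⟶ Z} {n : ℤ} (M : T)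
    (h : ∀ x : Y ⟶ (S.obj M)⟦n⟧, f ≫ x = 0 ↔ ∃ y, g ≫ y = x) :
    Function.Exact ((shrinkHomMap k S g n).app M).hom ((shrinkHomMap k S f n).app M).hom :=
  shrinkMap_exact (f := Linear.leftComp k _ g) (g := Linear.leftComp k _ f) h

variable {S} in
lemma shrinkHomδ_exact {Z : D} [HomSmall.{u} S Z] {f : X ⟶ Y} {h : ShiftedHom Z X (1 : ℤ)}
    {n₀ n₁ : ℤ} (hn : n₀ + 1 = n₁) (M : T)
    (H : ∀ x : X ⟶ (S.obj M)⟦n₀⟧, h.comp x hn = 0 ↔ ∃ y, f ≫ y = x) :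
    Function.Exact ((shrinkHomMap k S f n₀).app M).hom
      ((shrinkHomδ k S h n₀ n₁ hn).app M).hom :=
  shrinkMap_exact (f := Linear.leftComp k _ f) (g := shiftedHomLeftComp k _ h hn) H

variable {S} in
lemma exact_shrinkHomδ {Z : D} [HomSmall.{u} S Z] {g : X ⟶ Y} {h : ShiftedHom Y Z (1 : ℤ)}
    {n₀ n₁ : ℤ} (hn : n₀ + 1 = n₁) (M : T)
    (H : ∀ x : Y ⟶ (S.obj M)⟦n₁⟧, g ≫ x = 0 ↔ ∃ y : Z ⟶ (S.obj M)⟦n₀⟧, h.comp y hn = x) :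
    Function.Exact ((shrinkHomδ k S h n₀ n₁ hn).app M).hom
      ((shrinkHomMap k S g n₁).app M).hom :=
  shrinkMap_exact (f := shiftedHomLeftComp k _ h hn) (g := Linear.leftComp k _ g) H

lemma shrinkHomδ_app_apply (f : ShiftedHom X Y (1 : ℤ)) (n₀ n₁ : ℤ) (h : n₀ + 1 = n₁) (M : T)
    (x : Y ⟶ (S.obj M)⟦n₀⟧) :
    ((shrinkHomδ k S f n₀ n₁ h).app M).hom ((shrinkHomEquiv k S Y n₀ M).symm x) =
      (shrinkHomEquiv k S X n₁ M).symm (ShiftedHom.comp f x h) :=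
  shrinkMap_apply (shiftedHomLeftComp k _ f h) x

end Precomp

end HomFunctor

lemma comp_shiftedHom_comp_of_eq {D : Type*} [Category* D] [HasShift D ℤ] {X X' Y Y' Z : D}
    {a n m : ℤ} {p : X ⟶ Y} {f : ShiftedHom Y Y' a} {g : ShiftedHom X X' a} {q : X' ⟶ Y'}
    (h : p ≫ f = g ≫ q⟦a⟧') (x : ShiftedHom Y' Z n) (hn : n + a = m) :
    p ≫ f.comp x hn = g.comp (q ≫ x : ShiftedHom X' Z n) hn := by
  simp [ShiftedHom.comp, reassoc_of% h]

/-! ### Long exact sequences of Hom(-, Z[n]) for a distinguished triangle. -/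

section Triangle

open Pretriangulated

variable {D : Type*} [Category* D] [Preadditive D] [HasZeroObject D]
  [HasShift D ℤ] [∀ n : ℤ, (shiftFunctor D n).Additive] [Pretriangulated D]
  {Y₁ Y₂ Y₃ : D} {f : Y₁ ⟶ Y₂} {g : Y₂ ⟶ Y₃} {h : ShiftedHom Y₃ Y₁ (1 : ℤ)}
  (hT : Triangle.mk f g h ∈ distTriang D) {Z : D}

include hT

lemma shiftedHom_comp_eq_zero_iff {n₀ n₁ : ℤ} (hn : n₀ + 1 = n₁) (x : ShiftedHom Y₁ Z n₀) :
    h.comp x hn = 0 ↔ ∃ y : ShiftedHom Y₂ Z n₀, f ≫ y = x := by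
  constructor
  · intro hx
    have hx' : h ≫ x⟦(1 : ℤ)⟧' = 0 := by
      rw [ShiftedHom.comp, ← Category.assoc, Preadditive.IsIso.comp_right_eq_zero] at hx
      exact hx
    obtain ⟨y, hy⟩ := Triangle.yoneda_exact₃ _ (rot_of_distTriang _ hT) (x⟦(1 : ℤ)⟧') hx'
    obtain ⟨y, rfl⟩ := (shiftFunctor D (1 : ℤ)).map_surjective y
    change Y₂ ⟶ Z⟦n₀⟧ at y
    -- The sign compensates for the arrow -f[1] of the rotated triangle.
    refine ⟨-y, (shiftFunctor D (1 : ℤ)).map_injective ?_⟩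
    have hy : x⟦(1 : ℤ)⟧' = (-f⟦(1 : ℤ)⟧') ≫ y⟦(1 : ℤ)⟧' := hy
    rw [hy]
    simp
  · rintro ⟨y, rfl⟩
    have : h ≫ f⟦(1 : ℤ)⟧' = 0 := comp_distTriang_mor_zero₃₁ _ hT
    simp [ShiftedHom.comp, reassoc_of% this]

lemma comp_shiftedHom_eq_zero_iff {n₀ n₁ : ℤ} (hn : n₀ + 1 = n₁) (x : ShiftedHom Y₃ Z n₁) :
    g ≫ x = 0 ↔ ∃ y : ShiftedHom Y₁ Z n₀, h.comp y hn = x := by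
  constructor
  · intro hx
    obtain ⟨y, rfl⟩ : ∃ y : Y₁⟦(1 : ℤ)⟧ ⟶ Z⟦n₁⟧, x = h ≫ y := Triangle.yoneda_exact₃ _ hT x hx
    obtain ⟨z, hz⟩ := (shiftFunctor D (1 : ℤ)).map_surjective
      (y ≫ (shiftFunctorAdd' D n₀ 1 n₁ hn).hom.app Z)
    exact ⟨z, by simp [ShiftedHom.comp, hz]⟩
  · rintro ⟨y, rfl⟩
    have : g ≫ h = 0 := comp_distTriang_mor_zero₂₃ _ hT
    simp [ShiftedHom.comp, reassoc_of% this]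

lemma comp_eq_zero_iff_of_distTriang (x : Y₂ ⟶ Z) : f ≫ x = 0 ↔ ∃ y : Y₃ ⟶ Z, g ≫ y = x := by
  constructor
  · intro hx
    obtain ⟨y, hy⟩ := Triangle.yoneda_exact₂ _ hT x hx
    exact ⟨y, hy.symm⟩
  · rintro ⟨y, rfl⟩
    have : f ≫ g = 0 := comp_distTriang_mor_zero₁₂ _ hT
    rw [reassoc_of% this, zero_comp]

end Triangle

/-! ### From a triangulated to an abelian spectral object. -/

section SpectralObject

open Pretriangulated

variable (k : Type u) [Field k] {D : Type*} [Category* D] [Preadditive D] [Linear k D]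
  [HasZeroObject D] [HasShift D ℤ] [∀ n : ℤ, (shiftFunctor D n).Additive]
  [∀ n : ℤ, (shiftFunctor D n).Linear k] [Pretriangulated D]
  {T : Type*} [Category* T] (S : T ⥤ D)
  {ι ι' : Type*} [Preorder ι] [Preorder ι'] {σ : ι → ι'} (hσ : Antitone σ)
  (X : Triangulated.SpectralObject D ι')

/-- The arrow `σ j ⟶ σ i` attached to an arrow `i ⟶ j` and an order reversing map `σ`. -/
def reverseArrow (d : ComposableArrows ι 1) : ComposableArrows ι' 1 :=
  mk₁ (homOfLE (hσ (leOfHom (d.map' 0 1))))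

/-- The morphism between reversed arrows induced by a morphism of arrows. -/
def reverseArrowMap {d d' : ComposableArrows ι 1} (f : d ⟶ d') :
    reverseArrow hσ d' ⟶ reverseArrow hσ d :=
  homMk₁ (homOfLE (hσ (leOfHom (f.app 1)))) (homOfLE (hσ (leOfHom (f.app 0))))

variable [∀ d, HomSmall.{u} S (X.ω₁.obj d)]

/-- The spectral object in a functor category obtained by applying the functors `Hom(-, S(M)[n])`
to a spectral object in a triangulated category. -/
noncomputable def homSpectralObject : Abelian.SpectralObject (T ⥤ ModuleCat.{u} k) ι where
  H n :=
    { obj d := shrinkHom k S (X.ω₁.obj (reverseArrow hσ d)) n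
      map f := shrinkHomMap k S (X.ω₁.map (reverseArrowMap hσ f)) n
      map_id d := by
        rw [show reverseArrowMap hσ (𝟙 d) = 𝟙 _ from Subsingleton.elim _ _,
          CategoryTheory.Functor.map_id, shrinkHomMap_id]
      map_comp f g := by
        rw [show reverseArrowMap hσ (f ≫ g) = reverseArrowMap hσ g ≫ reverseArrowMap hσ f from
          Subsingleton.elim _ _, Functor.map_comp, shrinkHomMap_comp] }
  δ' n₀ n₁ h :=
    -- Reversing the order exchanges the two arrows of a composable pair.
    { app d := shrinkHomδ k S (X.δ (homOfLE (hσ (leOfHom (d.map' 1 2))))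
        (homOfLE (hσ (leOfHom (d.map' 0 1))))) n₀ n₁ h
      naturality d d' f := by
        ext M : 2
        refine ModuleCat.hom_ext ?_
        change shrinkMap _ ∘ₗ shrinkMap _ = shrinkMap _ ∘ₗ shrinkMap _
        refine shrinkMap_comp_congr fun x => ?_
        have := X.δ'.naturality (homMk₂
            (homOfLE (hσ (leOfHom (f.app 2))))
          (homOfLE (hσ (leOfHom (f.app 1)))) (homOfLE (hσ (leOfHom (f.app 0)))) :
          mk₂ (homOfLE (hσ (leOfHom (d'.map' 1 2)))) (homOfLE (hσ (leOfHom (d'.map' 0 1)))) ⟶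
          mk₂ (homOfLE (hσ (leOfHom (d.map' 1 2)))) (homOfLE (hσ (leOfHom (d.map' 0 1)))))
        have h₁ := (congrArg X.ω₁.map (Subsingleton.elim (reverseArrowMap hσ
          ((functorArrows ι 1 2 2).map f)) ((functorArrows ι' 0 1 2).map (homMk₂
            (homOfLE (hσ (leOfHom (f.app 2))))
          (homOfLE (hσ (leOfHom (f.app 1)))) (homOfLE (hσ (leOfHom (f.app 0)))) :
          mk₂ (homOfLE (hσ (leOfHom (d'.map' 1 2)))) (homOfLE (hσ (leOfHom (d'.map' 0 1)))) ⟶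
          mk₂ (homOfLE (hσ (leOfHom (d.map' 1 2)))) (homOfLE (hσ (leOfHom (d.map' 0 1))))))))
        have h₂ := (congrArg X.ω₁.map (Subsingleton.elim (reverseArrowMap hσ
          ((functorArrows ι 0 1 2).map f)) ((functorArrows ι' 1 2 2).map (homMk₂
            (homOfLE (hσ (leOfHom (f.app 2))))
          (homOfLE (hσ (leOfHom (f.app 1)))) (homOfLE (hσ (leOfHom (f.app 0)))) :
          mk₂ (homOfLE (hσ (leOfHom (d'.map' 1 2)))) (homOfLE (hσ (leOfHom (d'.map' 0 1)))) ⟶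
          mk₂ (homOfLE (hσ (leOfHom (d.map' 1 2)))) (homOfLE (hσ (leOfHom (d.map' 0 1))))))))
        refine (comp_shiftedHom_comp_of_eq ?_ x h).symm
        rw [h₁, h₂]
        exact this }
  exact₁' n₀ n₁ h d := composableArrows_exact_of_function_exact _ _ fun M =>
    exact_shrinkHomδ h M (comp_shiftedHom_eq_zero_iff (X.triangle_distinguished
      (homOfLE (hσ (leOfHom (d.map' 1 2)))) (homOfLE (hσ (leOfHom (d.map' 0 1))))) h)
  exact₂' n d := composableArrows_exact_of_function_exact _ _ fun M =>
    shrinkHomMap_exact M (comp_eq_zero_iff_of_distTriang (X.triangle_distinguished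
      (homOfLE (hσ (leOfHom (d.map' 1 2)))) (homOfLE (hσ (leOfHom (d.map' 0 1))))))
  exact₃' n₀ n₁ h d := composableArrows_exact_of_function_exact _ _ fun M =>
    shrinkHomδ_exact h M (shiftedHom_comp_eq_zero_iff (X.triangle_distinguished
      (homOfLE (hσ (leOfHom (d.map' 1 2)))) (homOfLE (hσ (leOfHom (d.map' 0 1))))) h)

end SpectralObject

end HochSS

namespace HochSS

open Limits ComposableArrows Pretriangulated

/-! ### Smallness of morphism groups by dévissage. -/

section Small

/-- Choose a set-theoretic section s of g over its image. Then w is determined by g(w) together with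
a chosen preimage under f of w - s(g(w)), so W injects into Z × V. -/
lemma small_of_function_exact {V W Z : Type*} [AddCommGroup W] [AddCommGroup Z]
    {f : V → W} {g : W →+ Z} (h : ∀ x, g x = 0 ↔ ∃ y, f y = x) [Small.{u} V] [Small.{u} Z] :
    Small.{u} W := by
  classical
  let s : Z → W := fun z => if hz : ∃ w, g w = z then hz.choose else 0
  have hs (w : W) : g (s (g w)) = g w := by
    have hz : ∃ w', g w' = g w := ⟨w, rfl⟩
    simp only [s, dif_pos hz, hz.choose_spec]
  have h' (w : W) : ∃ y, f y = w - s (g w) := (h _).1 (by rw [map_sub, hs, sub_self])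
  refine small_of_injective (f := fun w : W => (g w, (h' w).choose)) fun w w' hw => ?_
  simp only [Prod.mk.injEq] at hw
  have h₁ := (h' w).choose_spec
  rw [hw.2, (h' w').choose_spec, hw.1, sub_left_inj] at h₁
  exact h₁.symm

variable {D : Type*} [Category* D] [Preadditive D] [HasShift D ℤ]
  {T : Type*} [Category* T] {S : T ⥤ D}

omit [Preadditive D] in
lemma HomSmall.of_iso {X Y : D} (e : X ≅ Y) [HomSmall.{u} S X] : HomSmall.{u} S Y where
  small M n := small_of_injective (f := fun x : Y ⟶ (S.obj M)⟦n⟧ => e.hom ≫ x)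
    fun x y h => by simpa using h

omit [Preadditive D] in
lemma HomSmall.of_isZero {X : D} (h : IsZero X) : HomSmall.{u} S X where
  small M n := small_of_injective (f := fun _ : X ⟶ (S.obj M)⟦n⟧ => PUnit.unit.{u + 1})
    fun x y _ => h.eq_of_src x y

variable [HasZeroObject D] [∀ n : ℤ, (shiftFunctor D n).Additive] [Pretriangulated D]
  {Y₁ Y₂ Y₃ : D} {f : Y₁ ⟶ Y₂} {g : Y₂ ⟶ Y₃} {h : ShiftedHom Y₃ Y₁ (1 : ℤ)}
  (hT : Triangle.mk f g h ∈ distTriang D)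

include hT

lemma HomSmall.of_distTriang₂ [HomSmall.{u} S Y₁] [HomSmall.{u} S Y₃] : HomSmall.{u} S Y₂ where
  small M n := small_of_function_exact (g := Preadditive.leftComp ((S.obj M)⟦n⟧) f)
    (comp_eq_zero_iff_of_distTriang hT)

lemma HomSmall.of_distTriang₁ [HomSmall.{u} S Y₂] [HomSmall.{u} S Y₃] : HomSmall.{u} S Y₁ where
  small M n := small_of_function_exact
    (g := AddMonoidHom.mk' (fun x : ShiftedHom Y₁ (S.obj M) n => h.comp x rfl) (by simp))
    (shiftedHom_comp_eq_zero_iff hT rfl)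

end Small

section Truncation

variable {C : Type*} [Category* C] [Abelian C] [HasExt.{u} C] [HasDerivedCategory.{w} C]

open DerivedCategory

/-- Such an X is a shift of an object of C, and the morphisms in question are Ext groups, small by
`HasExt`. -/
lemma homSmall_of_isGE_of_isLE (X : DerivedCategory C) (n : ℤ) [X.IsGE n] [X.IsLE n] :
    HomSmall.{u} (singleFunctor C 0) X := by
  obtain ⟨Y, ⟨e⟩⟩ := X.exists_iso_singleFunctor_obj_of_isGE_of_isLE n
  have : HomSmall.{u} (singleFunctor C 0) ((singleFunctor C n).obj Y) :=
    ⟨fun M m => small_of_injective (f := fun x => x ≫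
      ((singleFunctors C).shiftIso m (-m) 0 (by simp)).hom.app M) fun x y h =>
        (cancel_mono _).1 h⟩
  exact .of_iso e.symm

variable (X : DerivedCategory C) [X.IsLE 0]

omit [HasExt.{u} C] in
lemma isZero_ω₁_obj (X : DerivedCategory C) (m : ℤ) [X.IsLE m] {i j : EInt} (h : i ≤ j)
    (hi : ((m : ℤ) : EInt) < i) :
    IsZero ((TStructure.t.spectralObject X).ω₁.obj (mk₁ (homOfLE h))) :=
  TStructure.t.isZero_eTruncGE_obj_obj ((TStructure.t.eTruncLT.obj j).obj X) m i hi

omit [HasExt.{u} C] in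
lemma isLE_ω₁_obj (X : DerivedCategory C) (m : ℤ) {i j : EInt} (h : i ≤ j)
    (hj : j ≤ ((m + 1 : ℤ) : EInt)) :
    ((TStructure.t.spectralObject X).ω₁.obj (mk₁ (homOfLE h))).IsLE m := by
  have : ((TStructure.t.eTruncLT.obj j).obj X).IsLE m :=
    TStructure.t.isLE_eTruncLT_obj_obj m j hj X
  change ((TStructure.t.eTruncGE.obj i).obj ((TStructure.t.eTruncLT.obj j).obj X)).IsLE m
  infer_instance

omit [HasExt.{u} C] in
lemma isGE_ω₁_obj (X : DerivedCategory C) (m : ℤ) {i j : EInt} (h : i ≤ j)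
    (hi : ((m : ℤ) : EInt) ≤ i) :
    ((TStructure.t.spectralObject X).ω₁.obj (mk₁ (homOfLE h))).IsGE m :=
  TStructure.t.isGE_eTruncGE_obj_obj m i hi _

/-- As X has no cohomology in positive degrees, τ_{≥n} X has only finitely many cohomology objects;
they are added one at a time. -/
lemma homSmall_ω₁_obj_top (n : ℤ) :
    HomSmall.{u} (singleFunctor C 0) ((TStructure.t.spectralObject X).ω₁.obj
      (mk₁ (homOfLE (le_top : ((n : ℤ) : EInt) ≤ ⊤)))) := by
  -- The lower bound is written 1 - m so that the induction starts with τ_{≥1} X = 0.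
  have key (m : ℕ) : HomSmall.{u} (singleFunctor C 0) ((TStructure.t.spectralObject X).ω₁.obj
      (mk₁ (homOfLE (le_top : ((1 - m : ℤ) : EInt) ≤ ⊤)))) := by
    induction m with
    | zero =>
      exact .of_isZero (isZero_ω₁_obj X 0 _ (by simp))
    | succ m hm =>
      have h₁ : ((1 - (m + 1 : ℕ) : ℤ) : EInt) ≤ ((1 - m : ℤ) : EInt) := by simp
      have h := (TStructure.t.spectralObject X).triangle_distinguished
        (homOfLE h₁) (homOfLE (le_top : ((1 - m : ℤ) : EInt) ≤ ⊤))
      have : HomSmall.{u} (singleFunctor C 0) ((TStructure.t.spectralObject X).ω₁.obj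
          (mk₁ (homOfLE h₁))) := by
        have := isGE_ω₁_obj X (1 - (m + 1 : ℕ)) h₁ le_rfl
        have := isLE_ω₁_obj X (1 - (m + 1 : ℕ)) h₁ (by simp)
        exact homSmall_of_isGE_of_isLE _ (1 - (m + 1 : ℕ))
      exact .of_distTriang₂ h
  by_cases hn : n ≤ 0
  · obtain ⟨m, hm⟩ := Int.eq_ofNat_of_zero_le (show 0 ≤ 1 - n by lia)
    obtain rfl : n = 1 - m := by lia
    exact key m
  · exact .of_isZero (isZero_ω₁_obj X 0 _ (by simpa using hn))

/-- The piece τ_{≥i} τ_{<j} X is the first vertex of a triangle whose others are τ_{≥i} X and τ_{≥j}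
X. For the bound ⊥ this is X itself, which may be unbounded below, so its smallness has to be
assumed. -/
instance homSmall_ω₁ [HomSmall.{u} (singleFunctor C 0) X] (d : ComposableArrows EInt 1) :
    HomSmall.{u} (singleFunctor C 0) ((TStructure.t.spectralObject X).ω₁.obj d) := by
  obtain ⟨i, j, f, rfl⟩ := mk₁_surjective d
  have key (i : EInt) : HomSmall.{u} (singleFunctor C 0) ((TStructure.t.spectralObject X).ω₁.obj
      (mk₁ (homOfLE (le_top : i ≤ ⊤)))) := by
    induction i using WithBotTop.rec with
    | bot => assumption
    | coe n => exact homSmall_ω₁_obj_top X n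
    | top => exact .of_isZero (isZero_ω₁_obj X 0 _ (WithBot.coe_lt_coe.2 (WithTop.coe_lt_top _)))
  have := key i
  have := key j
  exact .of_distTriang₁ ((TStructure.t.spectralObject X).triangle_distinguished f (homOfLE le_top))

end Truncation

section Reversal

/-- The order reversing involution `n ↦ 1 - n` of the extended integers. -/
def reverseEInt : EInt → EInt := WithBotTop.rec ⊤ (fun n => ((1 - n : ℤ) : EInt)) ⊥

/-- The interval [q, q+1) becomes [-q, 1-q): the index q of the spectral sequence selects the
cohomology of X in degree -q. -/
lemma reverseEInt_antitone : Antitone reverseEInt := by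
  intro i j h
  induction i using WithBotTop.rec <;> induction j using WithBotTop.rec <;>
    simp_all [reverseEInt]
  lia

end Reversal

/-! ### Vanishing outside the first quadrant. -/

section FirstQuadrant

variable (k : Type u) [Field k] {C : Type*} [Category* C] [Abelian C] [Linear k C] [HasExt.{u} C]
  [HasDerivedCategory.{w} C] (X : DerivedCategory C) [X.IsLE 0]

open DerivedCategory

variable [HomSmall.{u} (singleFunctor C 0) X]

/-- The spectral object which gives the spectral sequence with abutment `Hom(X, M[n])`. -/
noncomputable abbrev truncationSpectralObject : Abelian.SpectralObject (C ⥤ ModuleCat.{u} k) EInt :=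
  homSpectralObject k (singleFunctor C 0) reverseEInt_antitone (TStructure.t.spectralObject X)

lemma isZero_shrinkHom {D : Type*} [Category* D] [Preadditive D] [Linear k D]
    [HasShift D ℤ] {T : Type*} [Category* T]
    {S : T ⥤ D} {X : D} [HomSmall.{u} S X] {n : ℤ}
    (h : ∀ M, ∀ f : X ⟶ (S.obj M)⟦n⟧, f = 0) : IsZero (shrinkHom k S X n) := by
  rw [Functor.isZero_iff]
  intro M
  have : Subsingleton ((shrinkHom k S X n).obj M) :=
    ⟨fun x y => (shrinkHomEquiv k S X n M).injective ((h M _).trans (h M _).symm)⟩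
  exact ModuleCat.isZero_of_subsingleton _

instance : (truncationSpectralObject k X).IsFirstQuadrant where
  isZero₁ i j hij hj n := by
    -- A bound j ≤ 0 is reversed into 1 - j ≥ 1, above all the cohomology of X.
    refine isZero_shrinkHom k fun M f => (isZero_ω₁_obj X 0 _ ?_).eq_of_src f 0
    induction j using WithBotTop.rec with
    | bot => exact WithBot.coe_lt_coe.2 (WithTop.coe_lt_top _)
    | coe n =>
      have : n ≤ 0 := by simpa using hj
      simp [reverseEInt]
      lia
    | top => simp at hj
  isZero₂ i j hij n hi := by
    refine isZero_shrinkHom k fun M f => ?_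
    -- For n < i the truncated object lives in degrees at most -n - 1, while M[n] sits in degree -n;
    -- the t-structure forbids morphisms between them.
    have h : reverseEInt i ≤ ((-n - 1 + 1 : ℤ) : EInt) := by
      induction i using WithBotTop.rec with
      | bot => simp at hi
      | coe m =>
        have : n < m := by simpa using hi
        simp [reverseEInt]
        lia
      | top => simp [reverseEInt]
    have : ((TStructure.t.spectralObject X).ω₁.obj
        (reverseArrow reverseEInt_antitone (mk₁ (homOfLE hij)))).IsLE (-n - 1) :=
      isLE_ω₁_obj X (-n - 1) (reverseEInt_antitone hij) h
    have : (((singleFunctor C 0).obj M)⟦n⟧).IsGE (-n) := TStructure.t.isGE_shift _ 0 n (-n) (by lia)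
    exact TStructure.t.zero f (-n - 1) (-n) (by lia)

end FirstQuadrant

end HochSS

namespace HochSS

open Limits ComposableArrows Pretriangulated

lemma shiftedHom_comp_bijective {D : Type*} [Category* D] [HasShift D ℤ] {X Y Z : D} {a n m : ℤ}
    (b : ShiftedHom X Y a) [IsIso b] (h : n + a = m) :
    Function.Bijective (fun x : ShiftedHom Y Z n => b.comp x h) := by
  constructor
  · intro x y hxy
    exact (shiftFunctor D a).map_injective ((cancel_mono ((shiftFunctorAdd' D n a m h).inv.app Z)).1
      ((cancel_epi b).1 hxy))
  · intro y
    obtain ⟨x, hx⟩ := (shiftFunctor D a).map_surjective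
      (inv b ≫ y ≫ (shiftFunctorAdd' D n a m h).hom.app Z)
    exact ⟨x, by simp [ShiftedHom.comp, hx]⟩

/-! ### Ext groups as morphisms out of a shifted module. -/

section HomExt

variable {k : Type u} [Field k] {R : Type u} [Ring R] [Algebra k R]
  [HasDerivedCategory.{w} (ModuleCat.{u} R)]

open DerivedCategory Abelian

variable {X : DerivedCategory (ModuleCat.{u} R)} {N : ModuleCat.{u} R} {q : ℤ}
  (b : ShiftedHom X ((singleFunctor _ 0).obj N) q)

variable (k) in
/-- The map `Ext^p(N, M) → Hom(X, M[p+q])` given by a morphism `b : X ⟶ N[q]`. -/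
noncomputable def extToHom (p : ℕ) (n : ℤ) (hn : n = p + q) (M : ModuleCat.{u} R) :
    Ext N M p →ₗ[k] (X ⟶ ((singleFunctor _ 0).obj M)⟦n⟧) where
  toFun ζ := b.comp ζ.hom hn.symm
  map_add' := by simp
  map_smul' := by simp

lemma extToHom_bijective [IsIso b] (p : ℕ) (n : ℤ) (hn : n = p + q) (M : ModuleCat.{u} R) :
    Function.Bijective (extToHom k b p n hn M) :=
  (shiftedHom_comp_bijective b hn.symm).comp (Ext.homEquiv (X := N) (Y := M)).bijective

lemma extToHom_comp_mk₀ (p : ℕ) (n : ℤ) (hn : n = p + q) {M M' : ModuleCat.{u} R} (g : M ⟶ M')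
    (ζ : Ext N M p) :
    extToHom k b p n hn M' (ζ.comp (.mk₀ g) (add_zero p)) =
      extToHom k b p n hn M ζ ≫ ((singleFunctor _ 0).map g)⟦n⟧' := by
  change b.comp _ _ = (b.comp _ _ : ShiftedHom _ _ _) ≫ _
  rw [Ext.comp_hom, Ext.mk₀_hom, ← ShiftedHom.comp_mk₀ _ 0 rfl]
  exact (ShiftedHom.comp_assoc b ζ.hom (ShiftedHom.mk₀ 0 rfl ((singleFunctor _ 0).map g))
    hn.symm (zero_add _) (by lia)).symm

variable [HomSmall.{u} (singleFunctor (ModuleCat.{u} R) 0) X]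

variable (k) in
/-- The isomorphism `Ext^p(N, -) ≅ Hom(X, -[p+q])` when `X ≅ N[q]`. -/
noncomputable def extFunctorIsoShrinkHom [IsIso b] (p : ℕ) (n : ℤ) (hn : n = p + q) :
    extFunctor k N p ≅ shrinkHom k (singleFunctor (ModuleCat.{u} R) 0) X n :=
  NatIso.ofComponents (fun M => LinearEquiv.toModuleIso
    ((LinearEquiv.ofBijective _ (extToHom_bijective b p n hn M)).trans
      (shrinkHomEquiv k _ X n M).symm)) fun {M M'} g => by
    ext ζ
    refine Eq.trans ?_ (shrinkHom_map_apply _ X n g _).symm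
    exact congrArg _ (extToHom_comp_mk₀ b p n hn g ζ)

/-- This is associativity: δ·(b'·ζ) = (δ·b')·ζ = (b·O)·ζ = b·(O·ζ). A single relation between δ and
O thus describes the connecting map for all p and M. -/
lemma shrinkHomδ_extFunctorIsoShrinkHom {X' : DerivedCategory (ModuleCat.{u} R)}
    {N' : ModuleCat.{u} R} {q' : ℤ} {b : ShiftedHom X ((singleFunctor _ 0).obj N) q}
    {b' : ShiftedHom X' ((singleFunctor _ 0).obj N') q'}
    [HomSmall.{u} (singleFunctor (ModuleCat.{u} R) 0) X'] [IsIso b] [IsIso b']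
    {δ : ShiftedHom X X' (1 : ℤ)} {O : Ext N N' 2} {m : ℤ} (hm : (2 : ℕ) + q = m)
    (hm' : q' + 1 = m)
    (hO : b.comp O.hom hm = δ.comp b' hm') (p : ℕ) (n n' : ℤ) (hn : n = p + q')
    (hn' : n' = (p + 2 : ℕ) + q) (h : n + 1 = n') (M : ModuleCat.{u} R) (ζ : Ext N' M p) :
    ((shrinkHomδ k _ δ n n' h).app M).hom (((extFunctorIsoShrinkHom k b' p n hn).hom.app M).hom ζ) =
      ((extFunctorIsoShrinkHom k b (p + 2) n' hn').hom.app M).hom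
        (O.comp ζ (add_comm 2 p)) := by
  refine (shrinkHomδ_app_apply _ δ _ _ h M _).trans (congrArg _ ?_)
  change δ.comp (b'.comp ζ.hom _) _ = b.comp (O.comp ζ _).hom _
  rw [Ext.comp_hom, ← ShiftedHom.comp_assoc δ b' ζ.hom hm' _ (by lia), ← hO,
    ShiftedHom.comp_assoc]
  lia

end HomExt

/-! ### The second page and its differential. -/

section SecondPage

variable {k : Type u} [Field k] {R : Type u} [Ring R] [Algebra k R]
  [HasDerivedCategory.{w} (ModuleCat.{u} R)]

open DerivedCategory Abelian

/-- A sign with `secondPageSign (p + 2) = (-1) ^ p * secondPageSign p`. -/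
def secondPageSign (k : Type u) [Field k] (p : ℕ) : kˣ := (-1) ^ (p * (p / 2))

/-- Modulo 2, (p + 2)⌊(p + 2)/2⌋ = p⌊p/2⌋ + p. -/
lemma secondPageSign_add_two (p : ℕ) :
    (secondPageSign k (p + 2) : k) * (secondPageSign k p : k)⁻¹ = (-1) ^ p := by
  have h : (p + 2) * ((p + 2) / 2) = p * (p / 2) + p + 2 * (p / 2 + 1) := by
    rw [Nat.add_div_right _ two_pos]
    ring
  rw [secondPageSign, secondPageSign, h, pow_add, pow_add, pow_mul _ 2]
  push_cast
  rw [neg_one_sq, one_pow, mul_one, mul_right_comm, mul_inv_cancel₀ (by simp), one_mul]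

variable (X : DerivedCategory (ModuleCat.{u} R)) [X.IsLE 0]
  [HomSmall.{u} (singleFunctor (ModuleCat.{u} R) 0) X]

/-- The cohomology object `H^{-q}(X)[q]`. -/
noncomputable abbrev heartPiece (q : ℤ) : DerivedCategory (ModuleCat.{u} R) :=
  (TStructure.t.spectralObject X).ω₁.obj (reverseArrow reverseEInt_antitone
    (mk₁ (homOfLE (by simp : ((q : ℤ) : EInt) ≤ ((q + 1 : ℤ) : EInt)))))

/-- The multiplication of an isomorphism of functors by a non-zero scalar. -/
@[simps]
def unitSMulIso {T : Type*} [Category* T] {F G : T ⥤ ModuleCat.{u} k} (c : kˣ) (A : F ≅ G) :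
    F ≅ G where
  hom := (c : k) • A.hom
  inv := (c : k)⁻¹ • A.inv

lemma unitSMulIso_apply {T : Type*} [Category* T] {F₁ F₂ G₁ G₂ : T ⥤ ModuleCat.{u} k}
    (A : F₂ ≅ G₂) (B : F₁ ≅ G₁) (c c' : kˣ) (M : T) (d : F₁.obj M →ₗ[k] F₂.obj M) (x : G₁.obj M) :
    ((unitSMulIso c' A).hom.app M).hom (d (((unitSMulIso c B).inv.app M).hom x)) =
      ((c' : k) * (c : k)⁻¹) • (A.hom.app M).hom (d ((B.inv.app M).hom x)) := by
  change (c' : k) • (A.hom.app M).hom (d ((c : k)⁻¹ • (B.inv.app M).hom x)) = _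
  rw [map_smul, map_smul, mul_smul]

lemma transport_apply {T : Type*} [Category* T] {F₁ F₂ G₁ G₂ E₁ E₂ : T ⥤ ModuleCat.{u} k}
    (B : F₁ ≅ G₁) (A : F₂ ≅ G₂) (Ψ₁ : E₁ ≅ G₁) (Ψ₂ : E₂ ≅ G₂) (M : T)
    {d : F₁.obj M → F₂.obj M} {D : G₁.obj M → G₂.obj M}
    (h : ∀ y, (A.hom.app M).hom (d y) = D ((B.hom.app M).hom y)) {x : E₁.obj M} {x' : E₂.obj M}
    (hx : D ((Ψ₁.hom.app M).hom x) = (Ψ₂.hom.app M).hom x') :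
    ((A ≪≫ Ψ₂.symm).hom.app M).hom (d (((B ≪≫ Ψ₁.symm).inv.app M).hom x)) = x' := by
  have h₁ := h (((B ≪≫ Ψ₁.symm).inv.app M).hom x)
  have h₂ : (B.hom.app M).hom (((B ≪≫ Ψ₁.symm).inv.app M).hom x) = (Ψ₁.hom.app M).hom x :=
    natTrans_app_congr (show (B ≪≫ Ψ₁.symm).inv ≫ B.hom = Ψ₁.hom by simp) M x
  rw [h₂, hx] at h₁
  refine (congrArg (Ψ₂.inv.app M).hom h₁).trans ?_
  exact natTrans_app_congr Ψ₂.hom_inv_id M x'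

theorem exists_iso_ext_and_differential (N : ℕ → ModuleCat.{u} R)
    (b : ∀ q : ℕ, heartPiece X q ≅ ((singleFunctor _ 0).obj (N q))⟦(q : ℤ)⟧) :
    ∃ (e : ∀ p q : ℕ, spectralSequenceEval (truncationSpectralObject k X).E₂SpectralSequenceNat ⋙
          SpectralSequence.pageFunctor _ _ 2 2 two_le_two ⋙ HomologicalComplex.eval _ _ (p, q)
        ≅ extFunctor k (N q) p)
      (O : ∀ q : ℕ, Ext (N q) (N (q + 1)) 2),
      ∀ (M : ModuleCat.{u} R) (p q : ℕ) (ζ : Ext (N (q + 1)) M p),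
        ((e (p + 2) q).hom.app M).hom
            (((((spectralSequenceEval (truncationSpectralObject k X).E₂SpectralSequenceNat).obj
              M).page 2 two_le_two).d (p, q + 1) (p + 2, q)).hom
              (((e p (q + 1)).inv.app M).hom ζ)) =
          (-1 : k) ^ p • (O q).comp ζ (add_comm 2 p) := by
  let Y := truncationSpectralObject k X
  let β (q : ℕ) : ShiftedHom (heartPiece X q) ((singleFunctor _ 0).obj (N q)) (q : ℤ) := (b q).hom
  have (q : ℕ) : IsIso (β q) := inferInstanceAs (IsIso (b q).hom)
  let e₀ (p q : ℕ) : spectralSequenceEval Y.E₂SpectralSequenceNat ⋙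
      SpectralSequence.pageFunctor _ _ 2 2 two_le_two ⋙ HomologicalComplex.eval _ _ (p, q)
        ≅ extFunctor k (N q) p :=
    spectralObjectE₂Iso Y p q _ rfl ≪≫ (extFunctorIsoShrinkHom k (β q) p _ rfl).symm
  let δ (q : ℕ) : ShiftedHom (heartPiece X q) (heartPiece X (q + 1 : ℕ)) (1 : ℤ) :=
    (TStructure.t.spectralObject X).δ (homOfLE (reverseEInt_antitone (by simp)))
      (homOfLE (reverseEInt_antitone (by simp)))
  -- The composite goes from H^{-q}(X)[q] to N_{q+1}[(q+1)+1]. As β q is an isomorphism onto N_q[q],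
  -- it corresponds to a class of degree 2.
  have hO (q : ℕ) : ∃ O : Ext (N q) (N (q + 1)) 2,
      (β q).comp O.hom (show ((2 : ℕ) : ℤ) + q = (2 : ℕ) + q from rfl) =
        (δ q).comp (β (q + 1)) (by push_cast; ring) :=
    (extToHom_bijective (k := k) (β q) 2 ((2 : ℕ) + q) rfl (N (q + 1))).2 _
  choose O hO using hO
  have key (M : ModuleCat.{u} R) (p q : ℕ) (ζ : Ext (N (q + 1)) M p) :
      ((e₀ (p + 2) q).hom.app M).hom
        (((((spectralSequenceEval Y.E₂SpectralSequenceNat).obj M).page 2 two_le_two).d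
          (p, q + 1) (p + 2, q)).hom (((e₀ p (q + 1)).inv.app M).hom ζ)) =
        (O q).comp ζ (add_comm 2 p) :=
    transport_apply _ _ _ _ M
      (spectralObjectE₂Iso_d Y p q _ _ rfl rfl (by push_cast; ring) M)
      (shrinkHomδ_extFunctorIsoShrinkHom _ _ (hO q) p _ _ rfl rfl _ M ζ)
  -- With e₀ the differential is ζ ↦ ζ ∘ O without sign; rescaling e₀ in column p by
  -- `secondPageSign` inserts (-1)^p.
  refine ⟨fun p q => unitSMulIso (secondPageSign k p) (e₀ p q), O, fun M p q ζ =>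
    (unitSMulIso_apply _ _ _ _ M _ _).trans ?_⟩
  rw [secondPageSign_add_two]
  exact congrArg ((-1 : k) ^ p • ·) (key M p q ζ)

end SecondPage

end HochSS

namespace HochSS

open Limits DerivedCategory Abelian

/-! ### K-projective complexes and adjunctions on derived categories. -/

section KProjective

variable {C : Type*} [Category* C] [Abelian C] [HasDerivedCategory.{w} C]

/-- Morphisms in the derived category out of a K-projective complex are homotopy classes of chain
maps. -/
lemma exists_Q_map_eq (K L : CochainComplex C ℤ) [K.IsKProjective] (f : Q.obj K ⟶ Q.obj L) :
    ∃ g : K ⟶ L, Q.map g = f := by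
  obtain ⟨g, hg⟩ := (CochainComplex.IsKProjective.Qh_map_bijective K
    ((HomotopyCategory.quotient _ _).obj L)).2
    ((quotientCompQhIso C).hom.app K ≫ f ≫ (quotientCompQhIso C).inv.app L)
  obtain ⟨g, rfl⟩ := (HomotopyCategory.quotient _ _).map_surjective g
  refine ⟨g, ?_⟩
  rw [← cancel_epi ((quotientCompQhIso C).hom.app K), ← quotientCompQhIso_hom_naturality, hg]
  simp

lemma nonempty_homotopy_zero_of_Q_map_eq_zero {K L : CochainComplex C ℤ} [K.IsKProjective]
    (f : K ⟶ L) (hf : Q.map f = 0) : Nonempty (Homotopy f 0) := by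
  refine ⟨HomotopyCategory.homotopyOfEq _ _
    ((CochainComplex.IsKProjective.Qh_map_bijective K _).1 ?_)⟩
  rw [← cancel_mono ((quotientCompQhIso C).hom.app L), quotientCompQhIso_hom_naturality, hf]
  simp

end KProjective

section Adjunction

variable {C₁ C₂ : Type*} [Category* C₁] [Category* C₂] [Abelian C₁] [Abelian C₂]
  [HasDerivedCategory.{w} C₁] [HasDerivedCategory.{w} C₂] {G : C₁ ⥤ C₂} {Φ : C₂ ⥤ C₁}
  [G.Additive] [Φ.Additive] (adj : G ⊣ Φ)

/-- The unit of an adjunction of additive functors, on cochain complexes. -/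
@[simps]
def complexUnit (K : CochainComplex C₁ ℤ) : K ⟶ (Φ.mapHomologicalComplex (.up ℤ)).obj
    ((G.mapHomologicalComplex (.up ℤ)).obj K) where
  f i := adj.unit.app (K.X i)
  comm' i j _ := (adj.unit.naturality (K.d i j)).symm

/-- The counit of an adjunction of additive functors, on cochain complexes. -/
@[simps]
def complexCounit (L : CochainComplex C₂ ℤ) : (G.mapHomologicalComplex (.up ℤ)).obj
    ((Φ.mapHomologicalComplex (.up ℤ)).obj L) ⟶ L where
  f i := adj.counit.app (L.X i)
  comm' i j _ := (adj.counit.naturality (L.d i j)).symm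

omit [HasDerivedCategory.{w} C₁] [HasDerivedCategory.{w} C₂] in
lemma complexUnit_map_counit {K : CochainComplex C₁ ℤ} {L : CochainComplex C₂ ℤ}
    (γ : K ⟶ (Φ.mapHomologicalComplex (.up ℤ)).obj L) :
    complexUnit adj K ≫ (Φ.mapHomologicalComplex (.up ℤ)).map
      ((G.mapHomologicalComplex (.up ℤ)).map γ ≫ complexCounit adj L) = γ := by
  have h {X : C₁} {Y : C₂} (g : X ⟶ Φ.obj Y) :
      adj.unit.app X ≫ Φ.map (G.map g ≫ adj.counit.app Y) = g := by simp
  ext i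
  exact h (γ.f i)

omit [HasDerivedCategory.{w} C₁] [HasDerivedCategory.{w} C₂] in
lemma map_complexUnit_counit {K : CochainComplex C₁ ℤ} {L : CochainComplex C₂ ℤ}
    (γ : (G.mapHomologicalComplex (.up ℤ)).obj K ⟶ L) :
    (G.mapHomologicalComplex (.up ℤ)).map
      (complexUnit adj K ≫ (Φ.mapHomologicalComplex (.up ℤ)).map γ) ≫ complexCounit adj L = γ := by
  have h {X : C₁} {Y : C₂} (g : G.obj X ⟶ Y) :
      G.map (adj.unit.app X ≫ Φ.map g) ≫ adj.counit.app Y = g := by simp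
  ext i
  exact h (γ.f i)

variable [PreservesFiniteLimits Φ] [PreservesFiniteColimits Φ]

/-- The universal morphism from `K` to the image under `Φ` of the complex `G(K)`, in the derived
category. -/
noncomputable def derivedUnit (K : CochainComplex C₁ ℤ) :
    Q.obj K ⟶ Φ.mapDerivedCategory.obj (Q.obj ((G.mapHomologicalComplex (.up ℤ)).obj K)) :=
  Q.map (complexUnit adj K) ≫ Φ.mapDerivedCategoryFactors.inv.app _

lemma derivedUnit_comp (K : CochainComplex C₁ ℤ) {L : CochainComplex C₂ ℤ}
    (γ : (G.mapHomologicalComplex (.up ℤ)).obj K ⟶ L) :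
    derivedUnit adj K ≫ Φ.mapDerivedCategory.map (Q.map γ) =
      Q.map (complexUnit adj K ≫ (Φ.mapHomologicalComplex (.up ℤ)).map γ) ≫
        Φ.mapDerivedCategoryFactors.inv.app L := by
  have := Φ.mapDerivedCategoryFactors.inv.naturality γ
  dsimp at this
  simp [derivedUnit, this]

/-- Both K and G(K) are K-projective, so both sides are homotopy classes of chain maps, on which the
adjunction acts degree by degree. No derived functor of G is needed. -/
theorem derivedUnit_comp_bijective (K : CochainComplex C₁ ℤ) [K.IsKProjective]
    [CochainComplex.IsKProjective ((G.mapHomologicalComplex (.up ℤ)).obj K)]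
    (Y : DerivedCategory C₂) :
    Function.Bijective (fun f : Q.obj ((G.mapHomologicalComplex (.up ℤ)).obj K) ⟶ Y =>
      derivedUnit adj K ≫ Φ.mapDerivedCategory.map f) := by
  suffices ∀ L : CochainComplex C₂ ℤ, Function.Bijective
      (fun f : Q.obj ((G.mapHomologicalComplex (.up ℤ)).obj K) ⟶ Q.obj L =>
        derivedUnit adj K ≫ Φ.mapDerivedCategory.map f) by
    let e := Q.objObjPreimageIso Y
    have h := (Iso.homToEquiv (Φ.mapDerivedCategory.mapIso e) (Z := Q.obj K)).bijective.comp
      ((this (Q.objPreimage Y)).comp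
        (Iso.homToEquiv e.symm
          (Z := Q.obj ((G.mapHomologicalComplex (.up ℤ)).obj K))).bijective)
    convert h using 2 with f
    simp [← Functor.map_comp]
  intro L
  constructor
  · intro f f' hf
    rw [← sub_eq_zero]
    obtain ⟨g, hg⟩ := exists_Q_map_eq _ _ (f - f')
    have h : derivedUnit adj K ≫ Φ.mapDerivedCategory.map (f - f') = 0 := by
      rw [Functor.map_sub, Preadditive.comp_sub, sub_eq_zero]
      exact hf
    rw [← hg, derivedUnit_comp, Preadditive.IsIso.comp_right_eq_zero] at h
    obtain ⟨H⟩ := nonempty_homotopy_zero_of_Q_map_eq_zero _ h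
    -- The adjoint of g is null-homotopic; applying G and the counit carries the homotopy back to g.
    have H' : Homotopy g 0 := (Homotopy.ofEq (map_complexUnit_counit adj g).symm).trans
      (((G.mapHomotopy H).compRight (complexCounit adj L)).trans (.ofEq (by simp)))
    rw [← hg, Q_map_eq_of_homotopy _ H', Functor.map_zero]
  · intro f
    obtain ⟨γ, hγ⟩ := exists_Q_map_eq _ _ (f ≫ Φ.mapDerivedCategoryFactors.hom.app L)
    refine ⟨Q.map ((G.mapHomologicalComplex (.up ℤ)).map γ ≫ complexCounit adj L), ?_⟩
    dsimp only
    rw [derivedUnit_comp, complexUnit_map_counit, hγ]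
    simp

end Adjunction

/-! ### Identification of the abutment. -/

section Abutment

variable {k : Type u} [Field k] {R₁ R₂ : Type u} [Ring R₁] [Ring R₂] [Algebra k R₁] [Algebra k R₂]
  {G : ModuleCat.{u} R₁ ⥤ ModuleCat.{u} R₂} {Φ : ModuleCat.{u} R₂ ⥤ ModuleCat.{u} R₁}
  [G.Additive] [Φ.Additive] [Φ.Linear k] (adj : G ⊣ Φ)
  [PreservesFiniteLimits Φ] [PreservesFiniteColimits Φ]
  [HasDerivedCategory.{w} (ModuleCat.{u} R₁)] [HasDerivedCategory.{w} (ModuleCat.{u} R₂)]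
  {A : ModuleCat.{u} R₁} (P : ProjectiveResolution A)

/-- The object of the derived category which is given by the image of a projective resolution under
an additive functor `G`. -/
noncomputable abbrev leftDerivedObj (G : ModuleCat.{u} R₁ ⥤ ModuleCat.{u} R₂) [G.Additive]
    {A : ModuleCat.{u} R₁} (P : ProjectiveResolution A) : DerivedCategory (ModuleCat.{u} R₂) :=
  Q.obj ((G.mapHomologicalComplex (.up ℤ)).obj P.cochainComplex)

/-- The isomorphism in the derived category between a projective resolution and the object that it
resolves. -/
noncomputable def resolutionIso : Q.obj P.cochainComplex ≅ (singleFunctor _ 0).obj A :=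
  have : IsIso (Q.map P.π') := (isIso_Q_map_iff_quasiIso _ _).2 inferInstance
  asIso (Q.map P.π') ≪≫ ((singleFunctorIsoCompQ _ 0).app A).symm

variable (k) in
/-- The map `Hom(LG(A), M[n]) → Hom(A, Φ(M)[n])`. -/
noncomputable def adjunctionHom (M : ModuleCat.{u} R₂) (n : ℤ) :
    (leftDerivedObj G P ⟶ ((singleFunctor _ 0).obj M)⟦n⟧) →ₗ[k]
      ((singleFunctor _ 0).obj A ⟶ ((singleFunctor _ 0).obj (Φ.obj M))⟦n⟧) :=
  Linear.leftComp k _ ((resolutionIso P).inv ≫ derivedUnit adj P.cochainComplex) ∘ₗ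
    Linear.rightComp k _ ((Φ.mapDerivedCategory.commShiftIso n).hom.app _ ≫
      ((Φ.mapDerivedCategorySingleFunctor 0).hom.app M)⟦n⟧') ∘ₗ Functor.mapLinearMap k _

lemma adjunctionHom_apply (M : ModuleCat.{u} R₂) (n : ℤ)
    (f : leftDerivedObj G P ⟶ ((singleFunctor _ 0).obj M)⟦n⟧) :
    adjunctionHom k adj P M n f = ((resolutionIso P).inv ≫ derivedUnit adj P.cochainComplex) ≫
      Φ.mapDerivedCategory.map f ≫ (Φ.mapDerivedCategory.commShiftIso n).hom.app _ ≫
      ((Φ.mapDerivedCategorySingleFunctor 0).hom.app M)⟦n⟧' := rfl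

omit [HasDerivedCategory.{w} (ModuleCat.{u} R₁)] [HasDerivedCategory.{w} (ModuleCat.{u} R₂)] in
include adj in
-- A left adjoint of a functor preserving epimorphisms preserves projectives, and a bounded above
-- complex of projectives is K-projective.
lemma isKProjective_map_cochainComplex :
    CochainComplex.IsKProjective ((G.mapHomologicalComplex (.up ℤ)).obj P.cochainComplex) := by
  have : Φ.PreservesEpimorphisms := inferInstance
  have (n : ℤ) : Projective (((G.mapHomologicalComplex (.up ℤ)).obj P.cochainComplex).X n) :=
    adj.map_projective _ inferInstance
  have : CochainComplex.IsStrictlyLE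
    ((G.mapHomologicalComplex (.up ℤ)).obj P.cochainComplex) 0 := inferInstance
  exact CochainComplex.isKProjective_of_projective _ 0

lemma adjunctionHom_bijective (M : ModuleCat.{u} R₂) (n : ℤ) :
    Function.Bijective (adjunctionHom k adj P M n) := by
  have := isKProjective_map_cochainComplex adj P
  let e := (Φ.mapDerivedCategory.commShiftIso n).app ((singleFunctor _ 0).obj M) ≪≫
    (shiftFunctor _ n).mapIso ((Φ.mapDerivedCategorySingleFunctor 0).app M)
  have h := (Iso.homCongr (resolutionIso P) e).bijective.comp
    (derivedUnit_comp_bijective adj P.cochainComplex (((singleFunctor _ 0).obj M)⟦n⟧))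
  refine (congrArg Function.Bijective (funext fun f => ?_)).mp h
  simp [e, adjunctionHom_apply, Iso.homCongr]

lemma adjunctionHom_comp {M M' : ModuleCat.{u} R₂} (g : M ⟶ M') (n : ℤ)
    (f : leftDerivedObj G P ⟶ ((singleFunctor _ 0).obj M)⟦n⟧) :
    adjunctionHom k adj P M' n (f ≫ ((singleFunctor _ 0).map g)⟦n⟧') =
      adjunctionHom k adj P M n f ≫ ((singleFunctor _ 0).map (Φ.map g))⟦n⟧' := by
  have h₁ := (Φ.mapDerivedCategory.commShiftIso n).hom.naturality ((singleFunctor _ 0).map g)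
  have h₂ := (Φ.mapDerivedCategorySingleFunctor 0).hom.naturality g
  dsimp at h₁ h₂
  rw [adjunctionHom_apply, adjunctionHom_apply, Functor.map_comp]
  simp only [Category.assoc, reassoc_of% h₁]
  rw [← Functor.map_comp, ← Functor.map_comp, h₂]

variable (k) in
include k adj in
-- Dévissage does not reach this object, which may have infinitely many cohomology modules. The
-- adjunction embeds its morphism groups into Ext groups over R₁.
lemma homSmall_leftDerivedObj : HomSmall.{u} (singleFunctor _ 0) (leftDerivedObj G P) where
  small M n :=
    have : Small.{u} ((singleFunctor _ 0).obj A ⟶ ((singleFunctor _ 0).obj (Φ.obj M))⟦n⟧) :=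
      small_of_injective (f := fun x => x ≫
        ((singleFunctors _).shiftIso n (-n) 0 (by simp)).hom.app (Φ.obj M)) fun x y h =>
          (cancel_mono _).1 h
    small_of_injective (adjunctionHom_bijective (k := k) adj P M n).1

variable (k) in
/-- The natural isomorphism `Ext^n(A, Φ(M)) ≅ Hom(LG(A), M[n])`. -/
noncomputable def extFunctorIsoOfAdjunction [HomSmall.{u} (singleFunctor _ 0) (leftDerivedObj G P)]
    (n : ℕ) : Φ ⋙ extFunctor k A n ≅
      shrinkHom k (singleFunctor (ModuleCat.{u} R₂) 0) (leftDerivedObj G P) n :=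
  Iso.symm (NatIso.ofComponents (fun M => LinearEquiv.toModuleIso
    ((shrinkHomEquiv k _ _ n M).trans ((LinearEquiv.ofBijective _
      (adjunctionHom_bijective adj P M n)).trans Ext.homLinearEquiv.symm)))
    fun {M M'} g => by
      ext x
      obtain ⟨x, rfl⟩ := (shrinkHomEquiv k _ _ n M).symm.surjective x
      refine Ext.ext ?_
      have h₁ (N : ModuleCat.{u} R₁)
          (z : (singleFunctor _ 0).obj A ⟶ ((singleFunctor _ 0).obj N)⟦(n : ℤ)⟧) :
          ((Ext.homLinearEquiv (R := k)).symm z).hom = z :=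
        (Ext.homLinearEquiv (R := k)).apply_symm_apply z
      refine (congrArg (fun y => ((Ext.homLinearEquiv (R := k)).symm (adjunctionHom k adj P M' n
        (shrinkHomEquiv k _ _ n M' y))).hom) (shrinkHom_map_apply _ _ n g x)).trans ?_
      refine (h₁ _ _).trans ?_
      rw [LinearEquiv.apply_symm_apply, adjunctionHom_comp]
      refine Eq.trans ?_ (Ext.comp_hom _ _ (add_zero n)).symm
      rw [Ext.mk₀_hom, ShiftedHom.comp_mk₀]
      refine congrArg (· ≫ _) (Eq.trans ?_ (h₁ _ _).symm)
      exact congrArg (adjunctionHom k adj P M n) (LinearEquiv.apply_symm_apply _ _).symm)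

end Abutment

end HochSS

namespace HochSS

open Limits ComposableArrows Pretriangulated DerivedCategory

/-! ### The graded pieces of the truncation filtration. -/

section Heart

variable {C : Type*} [Category* C] [Abelian C] [HasDerivedCategory.{w} C]

lemma isIso_homologyFunctor_map_mor₁ (T : Triangle (DerivedCategory C)) (hT : T ∈ distTriang _)
    (n₀ n₁ : ℤ) (h : n₀ + 1 = n₁) (h₀ : IsZero ((homologyFunctor C n₀).obj T.obj₃))
    (h₁ : IsZero ((homologyFunctor C n₁).obj T.obj₃)) :
    IsIso ((homologyFunctor C n₁).map T.mor₁) := by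
  have := (HomologySequence.mono_homologyMap_mor₁_iff T hT n₀ n₁ h).2 (h₀.eq_of_src _ _)
  have := (HomologySequence.epi_homologyMap_mor₁_iff T hT n₁).2 (h₁.eq_of_tgt _ _)
  exact isIso_of_mono_of_epi _

lemma isIso_homologyFunctor_map_mor₂ (T : Triangle (DerivedCategory C)) (hT : T ∈ distTriang _)
    (n₀ n₁ : ℤ) (h : n₀ + 1 = n₁) (h₀ : IsZero ((homologyFunctor C n₀).obj T.obj₁))
    (h₁ : IsZero ((homologyFunctor C n₁).obj T.obj₁)) :
    IsIso ((homologyFunctor C n₀).map T.mor₂) := by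
  have := (HomologySequence.mono_homologyMap_mor₂_iff T hT n₀).2 (h₀.eq_of_src _ _)
  have := (HomologySequence.epi_homologyMap_mor₂_iff T hT n₀ n₁ h).2 (h₁.eq_of_tgt _ _)
  exact isIso_of_mono_of_epi _

/-- Both morphisms of the zigzag τ_{≥m} τ_{<m+1} X ← τ_{<m+1} X → X are isomorphisms on H^m, their
cones having no cohomology in the relevant degrees. -/
lemma nonempty_homology_truncation_iso (X : DerivedCategory C) {m m' : ℤ} (hm : m + 1 = m')
    (h : ((m : ℤ) : EInt) ≤ ((m' : ℤ) : EInt)) :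
    Nonempty ((homologyFunctor C m).obj ((TStructure.t.spectralObject X).ω₁.obj
      (mk₁ (homOfLE h))) ≅ (homologyFunctor C m).obj X) := by
  let Y := TStructure.t.spectralObject X
  have hX (n : ℤ) (hn : m ≤ n) : IsZero ((homologyFunctor C n).obj
      (Y.ω₁.obj (mk₁ (homOfLE (bot_le : (⊥ : EInt) ≤ ((m : ℤ) : EInt)))))) :=
    have := isLE_ω₁_obj X (m - 1) (bot_le : (⊥ : EInt) ≤ ((m : ℤ) : EInt)) (by simp)
    isZero_of_isLE _ (m - 1) _ (by lia)
  have hX' (n : ℤ) (hn : n ≤ m) : IsZero ((homologyFunctor C n).obj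
      (Y.ω₁.obj (mk₁ (homOfLE (le_top : ((m' : ℤ) : EInt) ≤ ⊤))))) :=
    have := isGE_ω₁_obj X m' (le_top : ((m' : ℤ) : EInt) ≤ ⊤) le_rfl
    isZero_of_isGE _ m' _ (by lia)
  have h₁ := isIso_homologyFunctor_map_mor₂ _ (Y.triangle_distinguished
    (homOfLE (bot_le : (⊥ : EInt) ≤ ((m : ℤ) : EInt))) (homOfLE h)) m (m + 1) rfl
    (hX _ le_rfl) (hX _ (by lia))
  have h₂ := isIso_homologyFunctor_map_mor₁ _ (Y.triangle_distinguished
    (homOfLE (bot_le : (⊥ : EInt) ≤ ((m' : ℤ) : EInt)))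
    (homOfLE (le_top : ((m' : ℤ) : EInt) ≤ ⊤))) (m - 1) m (by lia)
    (hX' _ (by lia)) (hX' _ le_rfl)
  exact ⟨(@asIso _ _ _ _ _ h₁).symm ≪≫ @asIso _ _ _ _ _ h₂⟩

/-- The homology of an object concentrated in degree `n`. -/
noncomputable def homologySingleFunctorIso (Y : C) (n : ℤ) :
    (homologyFunctor C n).obj ((singleFunctor C n).obj Y) ≅ Y :=
  (homologyFunctor C n).mapIso ((singleFunctorIsoCompQ C n).app Y) ≪≫
    (homologyFunctorFactors C n).app _ ≪≫
    (HomologicalComplex.homologyFunctorSingleIso C (.up ℤ) n).app Y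

end Heart

section

variable {R : Type u} [Ring R] [HasDerivedCategory.{w} (ModuleCat.{u} R)]

/-- An object concentrated in a single degree is determined by its cohomology there. -/
lemma nonempty_truncation_iso (X : DerivedCategory (ModuleCat.{u} R)) {m m' q : ℤ}
    (hm : m + 1 = m') (hq : q + m = 0) (h : ((m : ℤ) : EInt) ≤ ((m' : ℤ) : EInt))
    (N : ModuleCat.{u} R) (e : (homologyFunctor _ m).obj X ≅ N) :
    Nonempty ((TStructure.t.spectralObject X).ω₁.obj (mk₁ (homOfLE h)) ≅
      ((singleFunctor _ 0).obj N)⟦q⟧) := by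
  have := isLE_ω₁_obj X m h (by simp [hm])
  have := isGE_ω₁_obj X m h le_rfl
  obtain ⟨Y, ⟨e₁⟩⟩ := exists_iso_singleFunctor_obj_of_isGE_of_isLE
    ((TStructure.t.spectralObject X).ω₁.obj (mk₁ (homOfLE h))) m
  obtain ⟨e₂⟩ := nonempty_homology_truncation_iso X hm h
  let e₃ : Y ≅ N := (homologySingleFunctorIso Y m).symm ≪≫
    (homologyFunctor _ m).mapIso e₁.symm ≪≫ e₂ ≪≫ e
  exact ⟨e₁ ≪≫ (singleFunctor _ m).mapIso e₃ ≪≫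
    (((singleFunctors _).shiftIso q m 0 hq).app N).symm⟩

lemma nonempty_heartPiece_iso (X : DerivedCategory (ModuleCat.{u} R)) (q : ℤ) (N : ModuleCat.{u} R)
    (e : (homologyFunctor _ (-q)).obj X ≅ N) :
    Nonempty (heartPiece X q ≅ ((singleFunctor _ 0).obj N)⟦q⟧) :=
  nonempty_truncation_iso X (m := 1 - (q + 1)) (m' := 1 - q) (by ring) (by ring) (by simp) N
    (eqToIso (by congr 2; ring) ≪≫ e)

end

/-! ### Chain complexes of resolutions as cochain complexes. -/

section Extend

variable {C₁ C₂ : Type*} [Category* C₁] [Category* C₂] [Abelian C₁] [Abelian C₂]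
  (G : C₁ ⥤ C₂) [G.Additive]

/-- The compatibility of `extend.X` with an additive functor. -/
noncomputable def extendXMapIso {ι : Type*} {c : ComplexShape ι} (K : HomologicalComplex C₁ c) :
    ∀ x : Option ι, G.obj (HomologicalComplex.extend.X K x) ≅
      HomologicalComplex.extend.X ((G.mapHomologicalComplex c).obj K) x
  | some _ => Iso.refl _
  | none => G.mapZeroObject

lemma extendXMapIso_comp_d {ι : Type*} {c : ComplexShape ι} (K : HomologicalComplex C₁ c) :
    ∀ x y : Option ι, (extendXMapIso G K x).hom ≫
      HomologicalComplex.extend.d ((G.mapHomologicalComplex c).obj K) x y =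
      G.map (HomologicalComplex.extend.d K x y) ≫ (extendXMapIso G K y).hom
  | some _, some _ => (Category.id_comp _).trans (Category.comp_id _).symm
  | none, _ => (IsZero.of_iso (isZero_zero _) G.mapZeroObject).eq_of_src _ _
  | some _, none => (isZero_zero _).eq_of_tgt _ _

/-- Additive functors commute with the extension of complexes by zero. -/
noncomputable def mapExtendIso {ι ι' : Type*} {c : ComplexShape ι} {c' : ComplexShape ι'}
    (K : HomologicalComplex C₁ c) (e : c.Embedding c') :
    (G.mapHomologicalComplex c').obj (K.extend e) ≅
      ((G.mapHomologicalComplex c).obj K).extend e :=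
  HomologicalComplex.Hom.isoOfComponents (fun i => extendXMapIso G K (e.r i))
    fun _ _ _ => extendXMapIso_comp_d G K _ _

end Extend

section

variable {R₁ R₂ : Type u} [Ring R₁] [Ring R₂] [HasDerivedCategory.{w} (ModuleCat.{u} R₂)]
  (G : ModuleCat.{u} R₁ ⥤ ModuleCat.{u} R₂) [G.Additive] {A : ModuleCat.{u} R₁}
  (P : ProjectiveResolution A)

/-- The cohomology of the image of a projective resolution in the derived category. -/
noncomputable def homologyLeftDerivedObjIso (q : ℕ) :
    (homologyFunctor _ (-q : ℤ)).obj (leftDerivedObj G P) ≅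
      ((G.mapHomologicalComplex (.down ℕ)).obj P.complex).homology q :=
  (homologyFunctorFactors _ (-q : ℤ)).app _ ≪≫
    HomologicalComplex.homologyMapIso
      (mapExtendIso G P.complex ComplexShape.embeddingDownNat) _ ≪≫
    HomologicalComplex.extendHomologyIso _ ComplexShape.embeddingDownNat (by simp)

lemma nonempty_heartPiece_leftDerivedObj_iso (q : ℕ) {N : ModuleCat.{u} R₂}
    (e : ((G.mapHomologicalComplex (.down ℕ)).obj P.complex).homology q ≅ N) :
    Nonempty (heartPiece (leftDerivedObj G P) q ≅ ((singleFunctor _ 0).obj N)⟦(q : ℤ)⟧) :=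
  nonempty_heartPiece_iso _ _ _ (homologyLeftDerivedObjIso G P q ≪≫ e)

end

end HochSS

namespace HochSS

open Limits

section BalancedLift

variable {R S : Type u} [Ring R] [Ring S] (f : R →+* S)

/-- The universal property of `S ⊗_R M`. -/
noncomputable def baseChangeLift {M : ModuleCat.{u} R} {N : ModuleCat.{u} S}
    (h : M ⟶ (ModuleCat.restrictScalars f).obj N) : (baseChange f).obj M ⟶ N :=
  ModuleCat.ofHom ((balancedRel f M).liftQ
    (AlgebraTensorModule.lift
      { toFun s := ((DistribSMul.toAddMonoidHom N s).comp h.hom.toAddMonoidHom).toIntLinearMap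
        map_add' s s' := by ext m; exact add_smul s s' (show N from h m)
        map_smul' s s' := by ext m; exact mul_smul s s' (show N from h m) })
    (by
      refine Submodule.span_le.2 ?_
      rintro _ ⟨s, r, m, rfl⟩
      have : (s * f r) • (show N from h m) = s • (show N from h (r • m)) := by
        rw [mul_smul, map_smul]
        rfl
      simp only [SetLike.mem_coe, LinearMap.mem_ker, map_sub, sub_eq_zero]
      exact this))

end BalancedLift

/-! ### Modules over R ⊗ T as R-modules with an action of T. -/

section LeftPart

variable (k : Type u) [Field k] (R T : Type u) [Ring R] [Ring T] [Algebra k R] [Algebra k T]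

/-- The restriction of scalars along `R → R ⊗ T`. -/
noncomputable abbrev leftPart : ModuleCat.{u} (R ⊗[k] T) ⥤ ModuleCat.{u} R :=
  ModuleCat.restrictScalars
    ((Algebra.TensorProduct.includeLeft : R →ₐ[k] R ⊗[k] T) : R →+* R ⊗[k] T)

variable {T}

/-- The action of `t : T` on an `R ⊗ T`-module, as an endomorphism of the underlying
`R`-module. -/
noncomputable def rightAct (t : T) : leftPart k R T ⟶ leftPart k R T where
  app X := ModuleCat.ofHom (Y := (leftPart k R T).obj X) (X := (leftPart k R T).obj X)
    { toFun := fun x => ((1 : R) ⊗ₜ[k] t) • (show X from x)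
      map_add' := fun x y => smul_add _ (show X from x) (show X from y)
      map_smul' := fun r x => by
        change ((1 : R) ⊗ₜ[k] t) • (r ⊗ₜ[k] (1 : T)) • (show X from x) =
          (r ⊗ₜ[k] (1 : T)) • ((1 : R) ⊗ₜ[k] t) • (show X from x)
        rw [smul_smul, smul_smul]
        simp }
  naturality X Y g := by
    ext x
    exact (map_smul g.hom ((1 : R) ⊗ₜ[k] t) (show X from x)).symm

variable {k R}

/-- Morphisms of `R ⊗ T`-modules are the morphisms of `R`-modules which commute with the action
of `T`. -/
noncomputable def homOfLeftPart {X Y : ModuleCat.{u} (R ⊗[k] T)}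
    (g : (leftPart k R T).obj X ⟶ (leftPart k R T).obj Y)
    (hg : ∀ t : T, (rightAct k R t).app X ≫ g = g ≫ (rightAct k R t).app Y) : X ⟶ Y :=
  ModuleCat.ofHom
    { toFun := g.hom
      map_add' := fun x y => map_add g.hom x y
      map_smul' := fun z x => by
        change g.hom (show (leftPart k R T).obj X from z • x) = z • (show Y from g.hom x)
        induction z with
        | zero => rw [zero_smul, zero_smul]; exact map_zero g.hom
        | add z z' h h' => rw [add_smul, add_smul, ← h, ← h']; exact map_add g.hom _ _
        | tmul r t =>
          have h₁ (N : ModuleCat.{u} (R ⊗[k] T)) (y : N) :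
              (r ⊗ₜ[k] t) • y = (r ⊗ₜ[k] (1 : T)) • ((1 : R) ⊗ₜ[k] t) • y := by
            rw [smul_smul]; simp
          have h₂ := ConcreteCategory.congr_hom (hg t) x
          rw [h₁, h₁]
          exact (map_smul g.hom r _).trans (congrArg (fun y => (r ⊗ₜ[k] (1 : T)) • y) h₂) }

/-- Isomorphisms of `R ⊗ T`-modules are the isomorphisms of `R`-modules which commute with the
action of `T`. -/
noncomputable def isoOfLeftPart {X Y : ModuleCat.{u} (R ⊗[k] T)}
    (g : (leftPart k R T).obj X ≅ (leftPart k R T).obj Y)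
    (hg : ∀ t : T, (rightAct k R t).app X ≫ g.hom = g.hom ≫ (rightAct k R t).app Y) : X ≅ Y where
  hom := homOfLeftPart g.hom hg
  inv := homOfLeftPart g.inv fun t => by rw [Iso.comp_inv_eq, Category.assoc, Iso.eq_inv_comp, hg]
  hom_inv_id := by ext x; exact ConcreteCategory.congr_hom g.hom_inv_id x
  inv_hom_id := by ext x; exact ConcreteCategory.congr_hom g.inv_hom_id x

end LeftPart

section TensorModule

variable {k : Type u} [Field k] {S T : Type u} [Ring S] [Ring T] [Algebra k S] [Algebra k T]
  {M : Type u} [AddCommGroup M] [Module k M] [Module S M] [Module T M] [SMulCommClass S T M]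
  [IsScalarTower k S M] [IsScalarTower k T M]

attribute [local instance] TensorProduct.Algebra.module

lemma tmul_one_smul (s : S) (x : M) : (s ⊗ₜ[k] (1 : T)) • x = s • x := by
  rw [TensorProduct.Algebra.smul_def, one_smul]

lemma one_tmul_smul (t : T) (x : M) : ((1 : S) ⊗ₜ[k] t) • x = t • x := by
  rw [TensorProduct.Algebra.smul_def, one_smul]

end TensorModule

/-! ### Extension of scalars on one tensor factor, and its adjunction. -/

section PartialBaseChange

variable {k : Type u} [Field k] {R S : Type u} [Ring R] [Ring S] [Algebra k R] [Algebra k S]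
  (g : R →ₐ[k] S) {T : Type u} [Ring T] [Algebra k T]

/-- The `S ⊗ T`-module `S ⊗_R X`, for an `R ⊗ T`-module `X`. -/
def PartialBaseChange (X : ModuleCat.{u} (R ⊗[k] T)) : Type u :=
  (baseChange (g : R →+* S)).obj ((leftPart k R T).obj X)

variable (X : ModuleCat.{u} (R ⊗[k] T))

noncomputable instance : AddCommGroup (PartialBaseChange g X) :=
  inferInstanceAs (AddCommGroup ((baseChange (g : R →+* S)).obj ((leftPart k R T).obj X)))

noncomputable instance : Module S (PartialBaseChange g X) :=
  inferInstanceAs (Module S ((baseChange (g : R →+* S)).obj ((leftPart k R T).obj X)))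

noncomputable instance : Module k (PartialBaseChange g X) :=
  Module.restrictScalars k S _

instance : IsScalarTower k S (PartialBaseChange g X) :=
  IsScalarTower.restrictScalars k S _

/-- The action of `t : T` on `S ⊗_R X`. -/
noncomputable def partialBaseChangeAct (t : T) :
    PartialBaseChange g X →ₗ[S] PartialBaseChange g X :=
  ((baseChange (g : R →+* S)).map ((rightAct k R t).app X)).hom

/-- The canonical element `s ⊗ x` of `S ⊗_R X`. -/
noncomputable def partialBaseChangeMk (s : S) (x : X) : PartialBaseChange g X :=
  baseChangeMk (M := (leftPart k R T).obj X) (g : R →+* S) s x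

variable {X} in
lemma partialBaseChange_hom_ext {N : Type u} [AddCommGroup N] [Module S N]
    {a b : PartialBaseChange g X →ₗ[S] N}
    (H : ∀ s (x : X), a (partialBaseChangeMk g X s x) = b (partialBaseChangeMk g X s x)) : a = b :=
  baseChange_hom_ext (M := (leftPart k R T).obj X) (g : R →+* S) H

lemma partialBaseChangeAct_mk (t : T) (s : S) (x : X) :
    partialBaseChangeAct g X t (partialBaseChangeMk g X s x) =
      partialBaseChangeMk g X s (((1 : R) ⊗ₜ[k] t) • x) := rfl

lemma partialBaseChangeMk_add (s : S) (x y : X) : partialBaseChangeMk g X s (x + y) =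
    partialBaseChangeMk g X s x + partialBaseChangeMk g X s y :=
  (congrArg (balancedRel (g : R →+* S) ((leftPart k R T).obj X)).mkQ
    (TensorProduct.tmul_add (N := (leftPart k R T).obj X) s x y)).trans (map_add _ _ _)

lemma smul_partialBaseChangeMk (s s' : S) (x : X) :
    s • partialBaseChangeMk g X s' x = partialBaseChangeMk g X (s * s') x := rfl

lemma partialBaseChangeMk_balanced (s : S) (r : R) (x : X) :
    partialBaseChangeMk g X (s * g r) x = partialBaseChangeMk g X s ((r ⊗ₜ[k] (1 : T)) • x) :=
  baseChangeMk_balanced (M := (leftPart k R T).obj X) (g : R →+* S) s r x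

lemma partialBaseChangeAct_add (t t' : T) :
    partialBaseChangeAct g X (t + t') = partialBaseChangeAct g X t + partialBaseChangeAct g X t' :=
  partialBaseChange_hom_ext g fun s x => by
    rw [LinearMap.add_apply, partialBaseChangeAct_mk, partialBaseChangeAct_mk,
      partialBaseChangeAct_mk, TensorProduct.tmul_add, add_smul, partialBaseChangeMk_add]

lemma partialBaseChangeAct_mul (t t' : T) :
    partialBaseChangeAct g X (t * t') =
      partialBaseChangeAct g X t ∘ₗ partialBaseChangeAct g X t' :=
  partialBaseChange_hom_ext g fun s x => by
    rw [LinearMap.comp_apply, partialBaseChangeAct_mk, partialBaseChangeAct_mk,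
      partialBaseChangeAct_mk, smul_smul]
    simp

lemma partialBaseChangeAct_algebraMap (c : k) (y : PartialBaseChange g X) :
    partialBaseChangeAct g X (algebraMap k T c) y = c • y := by
  have : partialBaseChangeAct g X (algebraMap k T c) =
      Module.toModuleEnd S (PartialBaseChange g X) c :=
    partialBaseChange_hom_ext g fun s x => by
      have h₁ : (1 : R) ⊗ₜ[k] algebraMap k T c = algebraMap k R c ⊗ₜ[k] (1 : T) := by
        rw [Algebra.algebraMap_eq_smul_one, Algebra.algebraMap_eq_smul_one,
          TensorProduct.smul_tmul]
      rw [partialBaseChangeAct_mk, h₁, ← partialBaseChangeMk_balanced]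
      change _ = algebraMap k S c • partialBaseChangeMk g X s x
      rw [smul_partialBaseChangeMk, Algebra.commutes, AlgHom.commutes]
  rw [this]
  rfl

noncomputable instance : Module T (PartialBaseChange g X) where
  smul t y := partialBaseChangeAct g X t y
  one_smul y := by
    have := partialBaseChangeAct_algebraMap g X 1 y
    rwa [map_one, one_smul] at this
  mul_smul t t' y := LinearMap.congr_fun (partialBaseChangeAct_mul g X t t') y
  smul_zero t := map_zero (partialBaseChangeAct g X t)
  smul_add t := map_add (partialBaseChangeAct g X t)
  add_smul t t' y := LinearMap.congr_fun (partialBaseChangeAct_add g X t t') y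
  zero_smul y := by
    have := partialBaseChangeAct_algebraMap g X 0 y
    rwa [map_zero, zero_smul] at this

lemma smul_partialBaseChange (t : T) (y : PartialBaseChange g X) :
    t • y = partialBaseChangeAct g X t y := rfl

instance : SMulCommClass S T (PartialBaseChange g X) where
  smul_comm s t y := (map_smul (partialBaseChangeAct g X t) s y).symm

instance : IsScalarTower k T (PartialBaseChange g X) where
  smul_assoc c t y := by
    rw [Algebra.smul_def, mul_smul, smul_partialBaseChange, partialBaseChangeAct_algebraMap]

noncomputable instance : Module (S ⊗[k] T) (PartialBaseChange g X) := TensorProduct.Algebra.module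

/-- `S ⊗_R X` as an object of the category of `S ⊗ T`-modules. -/
noncomputable def partialBaseChangeObj : ModuleCat.{u} (S ⊗[k] T) :=
  ModuleCat.of (S ⊗[k] T) (PartialBaseChange g X)

/-- The `S`-module underlying `S ⊗_R X`. -/
noncomputable def leftPartPartialBaseChangeIso :
    (leftPart k S T).obj (partialBaseChangeObj g X) ≅
      (baseChange (g : R →+* S)).obj ((leftPart k R T).obj X) :=
  (AddEquiv.toLinearEquiv (M := (leftPart k S T).obj (partialBaseChangeObj g X))
    (M₂ := (baseChange (g : R →+* S)).obj ((leftPart k R T).obj X))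
    (AddEquiv.refl (PartialBaseChange g X))
    fun s y => by
      exact tmul_one_smul (k := k) (T := T) s (show PartialBaseChange g X from y)).toModuleIso

lemma rightAct_leftPartPartialBaseChangeIso_hom (t : T) :
    (rightAct k S t).app (partialBaseChangeObj g X) ≫ (leftPartPartialBaseChangeIso g X).hom =
      (leftPartPartialBaseChangeIso g X).hom ≫
        (baseChange (g : R →+* S)).map ((rightAct k R t).app X) := by
  ext y
  exact one_tmul_smul (k := k) (S := S) t (show PartialBaseChange g X from y)

variable (k T)

/-- The functor `S ⊗_R -` from `R ⊗ T`-modules to `S ⊗ T`-modules. -/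
noncomputable def partialBaseChange : ModuleCat.{u} (R ⊗[k] T) ⥤ ModuleCat.{u} (S ⊗[k] T) where
  obj X := partialBaseChangeObj g X
  map {X Y} f := homOfLeftPart ((leftPartPartialBaseChangeIso g X).hom ≫
      (baseChange (g : R →+* S)).map ((leftPart k R T).map f) ≫
        (leftPartPartialBaseChangeIso g Y).inv) fun t => by
    rw [← Category.assoc, rightAct_leftPartPartialBaseChangeIso_hom]
    simp only [Category.assoc]
    rw [Iso.cancel_iso_hom_left, ← Functor.map_comp_assoc, ← (rightAct k R t).naturality,
      Functor.map_comp_assoc]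
    congr 1
    rw [Iso.eq_inv_comp, ← Category.assoc, Iso.comp_inv_eq,
      rightAct_leftPartPartialBaseChangeIso_hom]
  map_id X := by
    ext y
    refine (ConcreteCategory.congr_hom (congrArg (baseChange (g : R →+* S)).map
      ((leftPart k R T).map_id X)) y).trans ?_
    exact ConcreteCategory.congr_hom ((baseChange (g : R →+* S)).map_id _) y
  map_comp {X Y Z} f f' := by
    ext y
    refine (ConcreteCategory.congr_hom (congrArg (baseChange (g : R →+* S)).map
      ((leftPart k R T).map_comp f f')) y).trans ?_
    exact ConcreteCategory.congr_hom ((baseChange (g : R →+* S)).map_comp _ _) y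

/-- The compatibility of `partialBaseChange` with `baseChange`. -/
noncomputable def partialBaseChangeLeftPart :
    partialBaseChange k g T ⋙ leftPart k S T ≅ leftPart k R T ⋙ baseChange (g : R →+* S) :=
  NatIso.ofComponents (fun X => leftPartPartialBaseChangeIso g X) fun _ => by
    ext y
    rfl

instance : (partialBaseChange k g T).Additive where
  map_add {X Y f f'} := by
    ext y
    refine (ConcreteCategory.congr_hom (congrArg (baseChange (g : R →+* S)).map
      ((leftPart k R T).map_add (f := f) (g := f'))) y).trans ?_
    exact ConcreteCategory.congr_hom ((baseChange (g : R →+* S)).map_add) y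

lemma rightAct_partialBaseChangeLeftPart_hom (t : T) (X : ModuleCat.{u} (R ⊗[k] T)) :
    (rightAct k S t).app ((partialBaseChange k g T).obj X) ≫
        (partialBaseChangeLeftPart k g T).hom.app X =
      (partialBaseChangeLeftPart k g T).hom.app X ≫
        (baseChange (g : R →+* S)).map ((rightAct k R t).app X) :=
  rightAct_leftPartPartialBaseChangeIso_hom g X t

end PartialBaseChange

end HochSS

namespace HochSS

open Limits

lemma preservesFinite_restrictScalars {R S : Type u} [Ring R] [Ring S] (f : R →+* S) :
    PreservesFiniteLimits (ModuleCat.restrictScalars.{u} f) ∧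
      PreservesFiniteColimits (ModuleCat.restrictScalars.{u} f) := by
  have h : ∀ T : ShortComplex (ModuleCat.{u} S), T.Exact →
      (T.map (ModuleCat.restrictScalars.{u} f)).Exact := fun T hT => by
    rw [ShortComplex.ShortExact.moduleCat_exact_iff_function_exact] at hT ⊢
    exact hT
  exact ((ModuleCat.restrictScalars.{u} f).exact_tfae.out 1 3).mp h

instance {R S : Type u} [Ring R] [Ring S] (f : R →+* S) :
    PreservesFiniteLimits (ModuleCat.restrictScalars.{u} f) :=
  (preservesFinite_restrictScalars f).1

instance {R S : Type u} [Ring R] [Ring S] (f : R →+* S) :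
    PreservesFiniteColimits (ModuleCat.restrictScalars.{u} f) :=
  (preservesFinite_restrictScalars f).2

section PartialAdjunction

variable (k : Type u) [Field k] {R S : Type u} [Ring R] [Ring S] [Algebra k R] [Algebra k S]
  (g : R →ₐ[k] S) (T : Type u) [Ring T] [Algebra k T]

/-- The restriction of scalars along `R ⊗ T → S ⊗ T`. -/
noncomputable abbrev partialRestriction :
    ModuleCat.{u} (S ⊗[k] T) ⥤ ModuleCat.{u} (R ⊗[k] T) :=
  ModuleCat.restrictScalars
    (Algebra.TensorProduct.map g (AlgHom.id k T) : R ⊗[k] T →+* S ⊗[k] T)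

variable {k T}

lemma hom_ext_partialBaseChange {X : ModuleCat.{u} (R ⊗[k] T)} {Y : ModuleCat.{u} (S ⊗[k] T)}
    {a b : (partialBaseChange k g T).obj X ⟶ Y}
    (h : ∀ s x, a (partialBaseChangeMk g X s x) = b (partialBaseChangeMk g X s x)) : a = b := by
  have : (partialBaseChangeLeftPart k g T).inv.app X ≫ (leftPart k S T).map a =
      (partialBaseChangeLeftPart k g T).inv.app X ≫ (leftPart k S T).map b :=
    ModuleCat.hom_ext (baseChange_hom_ext _ h)
  exact (leftPart k S T).map_injective ((cancel_epi _).1 this)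

/-- The unit `x ↦ 1 ⊗ x`. -/
noncomputable def partialBaseChangeUnit (X : ModuleCat.{u} (R ⊗[k] T)) :
    X ⟶ (partialRestriction k g T).obj ((partialBaseChange k g T).obj X) :=
  homOfLeftPart (ModuleCat.ofHom (X := (leftPart k R T).obj X)
      (Y := (leftPart k R T).obj ((partialRestriction k g T).obj ((partialBaseChange k g T).obj X)))
      { toFun x := partialBaseChangeMk g X 1 x
        map_add' := partialBaseChangeMk_add g X 1
        map_smul' r x := by
          refine (partialBaseChangeMk_balanced g X 1 r x).symm.trans ?_
          refine Eq.trans ?_ (tmul_one_smul (k := k) (T := T) (g r)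
            (partialBaseChangeMk g X 1 x)).symm
          exact congrArg (fun s => partialBaseChangeMk g X s x)
            ((one_mul (g r)).trans (mul_one (g r)).symm) })
    fun t => by
      ext x
      refine (partialBaseChangeAct_mk g X t 1 x).symm.trans ?_
      refine (one_tmul_smul (k := k) (S := S) t (partialBaseChangeMk g X 1 x)).symm.trans ?_
      change _ = (g 1 ⊗ₜ[k] t) • (show (partialBaseChange k g T).obj X from
        partialBaseChangeMk g X 1 x)
      rw [map_one]
      rfl

/-- The counit `s ⊗ y ↦ s y`. -/
noncomputable def partialBaseChangeCounit (Y : ModuleCat.{u} (S ⊗[k] T)) :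
    (partialBaseChange k g T).obj ((partialRestriction k g T).obj Y) ⟶ Y :=
  homOfLeftPart ((partialBaseChangeLeftPart k g T).hom.app _ ≫ baseChangeLift (g : R →+* S)
      (ModuleCat.ofHom (X := (leftPart k R T).obj ((partialRestriction k g T).obj Y))
        (Y := (ModuleCat.restrictScalars (g : R →+* S)).obj ((leftPart k S T).obj Y))
        { toFun y := y
          map_add' _ _ := rfl
          map_smul' r y := by
            change (g r ⊗ₜ[k] (1 : T)) • (show Y from y) = (g r ⊗ₜ[k] (1 : T)) • (show Y from y)
            rfl }))
    fun t => by
      rw [← Category.assoc, rightAct_partialBaseChangeLeftPart_hom]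
      simp only [Category.assoc]
      refine congrArg ((partialBaseChangeLeftPart k g T).hom.app _ ≫ ·) ?_
      refine ModuleCat.hom_ext (baseChange_hom_ext _ fun s y => ?_)
      change (s ⊗ₜ[k] (1 : T)) • (g 1 ⊗ₜ[k] t) • (show Y from y) =
        ((1 : S) ⊗ₜ[k] t) • (s ⊗ₜ[k] (1 : T)) • (show Y from y)
      rw [smul_smul, smul_smul]
      simp

variable (k T)

/-- The functor `S ⊗_R -` is left adjoint to the restriction of scalars. -/
noncomputable def partialAdjunction : partialBaseChange k g T ⊣ partialRestriction k g T where
  unit.app X := partialBaseChangeUnit g X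
  unit.naturality _ _ _ := rfl
  counit.app Y := partialBaseChangeCounit g Y
  counit.naturality X Y f := hom_ext_partialBaseChange g fun s x =>
    (map_smul f.hom (s ⊗ₜ[k] (1 : T)) (show X from x)).symm
  left_triangle_components X := hom_ext_partialBaseChange g fun s x => by
    refine (tmul_one_smul (k := k) (T := T) s (partialBaseChangeMk g X 1 x)).trans ?_
    rw [smul_partialBaseChangeMk, mul_one]
    rfl
  right_triangle_components Y := by
    ext y
    exact one_smul (S ⊗[k] T) (show Y from y)

end PartialAdjunction

section Swap

variable (k : Type u) [Field k] (R T : Type u) [Ring R] [Ring T] [Algebra k R] [Algebra k T]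

/-- The equivalence between `R ⊗ T`-modules and `T ⊗ R`-modules. -/
noncomputable def swapEquivalence : ModuleCat.{u} (R ⊗[k] T) ≌ ModuleCat.{u} (T ⊗[k] R) :=
  ModuleCat.restrictScalarsEquivalenceOfRingEquiv
    (Algebra.TensorProduct.comm k T R : T ⊗[k] R ≃ₐ[k] R ⊗[k] T).toRingEquiv

/-- An `R ⊗ T`-module, regarded as a `T ⊗ R`-module. -/
noncomputable abbrev swap : ModuleCat.{u} (R ⊗[k] T) ⥤ ModuleCat.{u} (T ⊗[k] R) :=
  (swapEquivalence k R T).functor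

instance : (swap k R T).Additive :=
  inferInstanceAs (ModuleCat.restrictScalarsEquivalenceOfRingEquiv _).functor.Additive

end Swap

/-! ### Two-sided extension of bimodules along φ. -/

section Enveloping

variable {k : Type u} [Field k] {A B : Type u} [Ring A] [Ring B] [Algebra k A] [Algebra k B]
  (φ : A →ₐ[k] B)

/-- The functor `- ⊗_A B` from `A`-bimodules to `A`-`B`-bimodules. -/
noncomputable def rightExtension : ModuleCat.{u} (A ⊗[k] Aᵐᵒᵖ) ⥤ ModuleCat.{u} (A ⊗[k] Bᵐᵒᵖ) :=
  swap k A Aᵐᵒᵖ ⋙ partialBaseChange k (AlgHom.op φ) A ⋙ swap k Bᵐᵒᵖ A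

/-- The functor `B ⊗_A - ⊗_A B` from `A`-bimodules to `B`-bimodules. -/
noncomputable def envelopingExtension :
    ModuleCat.{u} (A ⊗[k] Aᵐᵒᵖ) ⥤ ModuleCat.{u} (B ⊗[k] Bᵐᵒᵖ) :=
  rightExtension φ ⋙ partialBaseChange k φ Bᵐᵒᵖ

instance : (rightExtension φ).Additive := by
  unfold rightExtension
  infer_instance

instance : (envelopingExtension φ).Additive := by
  unfold envelopingExtension
  infer_instance

/-- The right adjoint of `rightExtension`. -/
noncomputable def rightExtensionAdjunction : rightExtension φ ⊣
    ((swapEquivalence k Bᵐᵒᵖ A).inverse ⋙ partialRestriction k (AlgHom.op φ) A) ⋙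
      (swapEquivalence k A Aᵐᵒᵖ).inverse :=
  (swapEquivalence k A Aᵐᵒᵖ).toAdjunction.comp
    ((partialAdjunction k (AlgHom.op φ) A).comp (swapEquivalence k Bᵐᵒᵖ A).toAdjunction)

/-- The morphism Aᵉ → Bᵉ factors through A ⊗ Bᵒᵖ, one side at a time; restricting along both factors
therefore gives the pull-back. -/
lemma envelopingMap_eq (z : A ⊗[k] Aᵐᵒᵖ) : envelopingMap φ z =
    Algebra.TensorProduct.map φ (AlgHom.id k Bᵐᵒᵖ) ((Algebra.TensorProduct.comm k Bᵐᵒᵖ A)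
      (Algebra.TensorProduct.map (AlgHom.op φ) (AlgHom.id k A)
        ((Algebra.TensorProduct.comm k Aᵐᵒᵖ A).symm z))) := by
  induction z with
  | zero => simp
  | tmul a b => simp [envelopingMap]
  | add x y hx hy => simp only [map_add, hx, hy]

/-- The functor `B ⊗_A - ⊗_A B` is left adjoint to the pull-back of bimodules. -/
noncomputable def envelopingAdjunction : envelopingExtension φ ⊣ pullback φ :=
  ((rightExtensionAdjunction φ).comp (partialAdjunction k φ Bᵐᵒᵖ)).ofNatIsoRight
    (NatIso.ofComponents (fun M => (AddEquiv.toLinearEquiv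
      (M := (partialRestriction k φ Bᵐᵒᵖ ⋙ ((swapEquivalence k Bᵐᵒᵖ A).inverse ⋙
        partialRestriction k (AlgHom.op φ) A) ⋙ (swapEquivalence k A Aᵐᵒᵖ).inverse).obj M)
      (M₂ := (pullback φ).obj M) (AddEquiv.refl M) fun z m => by
        exact congrArg (· • (show M from m)) (envelopingMap_eq φ z).symm).toModuleIso) fun _ => rfl)

instance : (pullback φ).Additive := inferInstanceAs (ModuleCat.restrictScalars _).Additive

instance : (pullback φ).Linear k :=
  inferInstanceAs ((ModuleCat.restrictScalars (envelopingMap φ).toRingHom).Linear k)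

instance : PreservesFiniteLimits (pullback φ) :=
  inferInstanceAs (PreservesFiniteLimits (ModuleCat.restrictScalars.{u}
    (envelopingMap φ : A ⊗[k] Aᵐᵒᵖ →+* B ⊗[k] Bᵐᵒᵖ)))

instance : PreservesFiniteColimits (pullback φ) :=
  inferInstanceAs (PreservesFiniteColimits (ModuleCat.restrictScalars.{u}
    (envelopingMap φ : A ⊗[k] Aᵐᵒᵖ →+* B ⊗[k] Bᵐᵒᵖ)))

end Enveloping

end HochSS

namespace HochSS

open Limits

/-! ### One-sided projectivity and resolutions. -/

section Projective

variable (k : Type u) [Field k] {R S : Type u} [Ring R] [Ring S] [Algebra k R] [Algebra k S]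
  (g : R →ₐ[k] S) (T : Type u) [Ring T] [Algebra k T]

/-- Over a field k, R ⊗ T is free over R; restricting to R a splitting of the canonical free cover
of X exhibits X as a summand of a free R-module. -/
lemma projective_leftPart_obj (X : ModuleCat.{u} (R ⊗[k] T)) [Projective X] :
    Projective ((leftPart k R T).obj X) := by
  have hX := (IsProjective.iff_projective (R := R ⊗[k] T) X).2 inferInstance
  obtain ⟨s, hs⟩ := (Module.projective_def' (R := R ⊗[k] T) (P := X)).1 hX
  let i : R →+* R ⊗[k] T := (Algebra.TensorProduct.includeLeft : R →ₐ[k] R ⊗[k] T)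
  let l : Module R X := Module.compHom X i
  have : IsScalarTower R (R ⊗[k] T) X := ⟨fun r z x => by
    change (r • z) • x = i r • z • x
    rw [smul_smul]
    congr 1
    induction z with
    | zero => simp
    | tmul a b => simp [i, TensorProduct.smul_tmul']
    | add x y hx hy => rw [smul_add, hx, hy, mul_add]⟩
  have : Module.Projective R X := Module.Projective.of_split (s.restrictScalars R)
    ((Finsupp.linearCombination (R ⊗[k] T) id).restrictScalars R) (by
      ext x
      exact LinearMap.congr_fun hs x)
  exact (IsProjective.iff_projective (R := R) ((leftPart k R T).obj X)).1 this

lemma projective_partialBaseChange_obj (X : ModuleCat.{u} (R ⊗[k] T)) [Projective X] :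
    Projective ((partialBaseChange k g T).obj X) :=
  (partialAdjunction k g T).map_projective _ inferInstance

lemma projective_swap_obj (X : ModuleCat.{u} (R ⊗[k] T)) [Projective X] :
    Projective ((swap k R T).obj X) :=
  (swapEquivalence k R T).map_projective_iff X |>.2 inferInstance

/-- Over R the quasi-isomorphism joins non-negative complexes of projectives, so it is a homotopy
equivalence and survives S ⊗_R -, although S need not be flat. Being a quasi-isomorphism over S ⊗ T
can be tested over S. -/
lemma quasiIso_partialBaseChange_map {K L : ChainComplex (ModuleCat.{u} (R ⊗[k] T)) ℕ}
    (f : K ⟶ L) [QuasiIso f] (hK : ∀ i, Projective ((leftPart k R T).obj (K.X i)))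
    (hL : ∀ i, Projective ((leftPart k R T).obj (L.X i))) :
    QuasiIso (((partialBaseChange k g T).mapHomologicalComplex _).map f) := by
  have : ∀ i, Projective ((((leftPart k R T).mapHomologicalComplex _).obj K).X i) := hK
  have : ∀ i, Projective ((((leftPart k R T).mapHomologicalComplex _).obj L).X i) := hL
  obtain ⟨e, he⟩ := (ChainComplex.quasiIso_iff_of_projective
    (((leftPart k R T).mapHomologicalComplex _).map f)).1 inferInstance
  have h₁ : QuasiIso (((baseChange (g : R →+* S)).mapHomologicalComplex _).map
      (((leftPart k R T).mapHomologicalComplex _).map f)) := by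
    rw [← he]
    exact inferInstanceAs (QuasiIso ((baseChange (g : R →+* S)).mapHomotopyEquiv e).hom)
  rw [← HomologicalComplex.quasiIso_map_iff_of_preservesHomology _ (leftPart k S T)]
  exact (quasiIso_iff_of_arrow_mk_iso _ _ (Arrow.isoMk
    ((NatIso.mapHomologicalComplex (partialBaseChangeLeftPart k g T) _).app K)
    ((NatIso.mapHomologicalComplex (partialBaseChangeLeftPart k g T) _).app L)
    ((NatIso.mapHomologicalComplex (partialBaseChangeLeftPart k g T) _).hom.naturality f).symm)).2
    h₁

lemma projective_obj_single₀_X {C D : Type*} [Category* C] [Category* D] [Abelian C] [Abelian D]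
    (F : C ⥤ D) [F.Additive] (X : C) [Projective (F.obj X)] (i : ℕ) :
    Projective (F.obj (((ChainComplex.single₀ C).obj X).X i)) := by
  cases i with
  | zero => assumption
  | succ i =>
    exact (F.map_isZero (HomologicalComplex.isZero_single_obj_X _ _ _ _ (by simp))).projective

end Projective

section Bimodule

variable {k : Type u} [Field k] {A B : Type u} [Ring A] [Ring B] [Algebra k A] [Algebra k B]
  (φ : A →ₐ[k] B)

lemma regularBimodule_smul (a : A) (a' : Aᵐᵒᵖ) (x : A) :
    (a ⊗ₜ[k] a') • (show regularBimodule k A from x) =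
      (show regularBimodule k A from a * x * a'.unop) := by
  let := instModuleTensorProductMop k A
  refine (TensorProduct.Algebra.smul_def (R := k) a a' x).trans ?_
  exact (mul_assoc a x a'.unop).symm

instance projective_leftPart_swap_regularBimodule :
    Projective ((leftPart k Aᵐᵒᵖ A).obj ((swap k A Aᵐᵒᵖ).obj (regularBimodule k A))) := by
  let N := (leftPart k Aᵐᵒᵖ A).obj ((swap k A Aᵐᵒᵖ).obj (regularBimodule k A))
  have e : Aᵐᵒᵖ ≃ₗ[Aᵐᵒᵖ] N := AddEquiv.toLinearEquiv (M := Aᵐᵒᵖ) (M₂ := N)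
      (MulOpposite.opAddEquiv.symm : Aᵐᵒᵖ ≃+ A) fun a x => by
        refine Eq.trans ?_ (regularBimodule_smul (1 : A) a x.unop).symm
        simp
        rfl
  exact (IsProjective.iff_projective (R := Aᵐᵒᵖ) N).1 (Module.Projective.of_equiv' e)

/-- A and the terms of P are projective as right A-modules, so - ⊗_A B keeps P a resolution. -/
lemma quasiIso_rightExtension_map (P : ProjectiveResolution (regularBimodule k A)) :
    QuasiIso (((rightExtension φ).mapHomologicalComplex _).map P.π) := by
  have h := quasiIso_partialBaseChange_map k (AlgHom.op φ) A
    (((swap k A Aᵐᵒᵖ).mapHomologicalComplex _).map P.π)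
    (fun i => have : Projective ((swap k A Aᵐᵒᵖ).obj (P.complex.X i)) := projective_swap_obj k _ _
      projective_leftPart_obj k A ((swap k A Aᵐᵒᵖ).obj (P.complex.X i)))
    (fun i =>
      have : Projective ((swap k A Aᵐᵒᵖ ⋙ leftPart k Aᵐᵒᵖ A).obj (regularBimodule k A)) :=
        projective_leftPart_swap_regularBimodule
      projective_obj_single₀_X (swap k A Aᵐᵒᵖ ⋙ leftPart k Aᵐᵒᵖ A) _ i)
  exact HomologicalComplex.quasiIso_map_of_preservesHomology
    (((partialBaseChange k (AlgHom.op φ) A).mapHomologicalComplex _).map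
      (((swap k A Aᵐᵒᵖ).mapHomologicalComplex _).map P.π)) (swap k Bᵐᵒᵖ A)

/-- With this, P ⊗_A B has projective terms over A and computes Tor^A(B, -). -/
lemma projective_leftPart_rightExtension_obj (X : ModuleCat.{u} (A ⊗[k] Aᵐᵒᵖ)) [Projective X] :
    Projective ((leftPart k A Bᵐᵒᵖ).obj ((rightExtension φ).obj X)) := by
  have := projective_swap_obj k _ X
  have := projective_partialBaseChange_obj k (AlgHom.op φ) A ((swap k A Aᵐᵒᵖ).obj X)
  have : Projective ((rightExtension φ).obj X) := projective_swap_obj k A _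
  exact projective_leftPart_obj k Bᵐᵒᵖ ((rightExtension φ).obj X)

end Bimodule

end HochSS

namespace HochSS

open Limits

/-! ### The bimodule A ⊗_A B and the two actions on Tor. -/

section RegularBimodule

variable {k : Type u} [Field k] {A B : Type u} [Ring A] [Ring B] [Algebra k A] [Algebra k B]
  (φ : A →ₐ[k] B)

/-- The algebra `B` as an `A`-`B`-bimodule, with the two factors of `A ⊗ Bᵒᵖ` exchanged. -/
noncomputable def mixedBimodule : ModuleCat.{u} (Bᵐᵒᵖ ⊗[k] A) :=
  (swap k A Bᵐᵒᵖ).obj ((partialRestriction k φ Bᵐᵒᵖ).obj (regularBimodule k B))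

lemma mixedBimodule_smul (a : A) (b : Bᵐᵒᵖ) (x : B) :
    (b ⊗ₜ[k] a) • (show mixedBimodule φ from x) =
      (show mixedBimodule φ from φ a * x * b.unop) :=
  regularBimodule_smul (k := k) (φ a) b x

/-- The morphism of bimodules `φ : A ⟶ B`. -/
noncomputable def bimoduleHom : (swap k A Aᵐᵒᵖ).obj (regularBimodule k A) ⟶
    (partialRestriction k (AlgHom.op φ) A).obj (mixedBimodule φ) :=
  ModuleCat.ofHom (X := (swap k A Aᵐᵒᵖ).obj (regularBimodule k A))
    (Y := (partialRestriction k (AlgHom.op φ) A).obj (mixedBimodule φ))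
    { toFun := fun x => φ x
      map_add' := fun x y => map_add φ x y
      map_smul' := fun z x => by
        let X := (swap k A Aᵐᵒᵖ).obj (regularBimodule k A)
        let Y := (partialRestriction k (AlgHom.op φ) A).obj (mixedBimodule φ)
        induction z with
        | zero =>
          exact (congrArg φ (zero_smul (Aᵐᵒᵖ ⊗[k] A) (show X from x))).trans
            ((map_zero φ).trans (zero_smul (Aᵐᵒᵖ ⊗[k] A) (show Y from φ x)).symm)
        | add z z' h h' =>
          exact (congrArg φ (add_smul z z' (show X from x))).trans
            ((map_add φ _ _).trans ((congrArg₂ (· + ·) h h').trans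
              (add_smul z z' (show Y from φ x)).symm))
        | tmul a' a =>
          refine (congrArg φ (regularBimodule_smul (k := k) a a' x)).trans
            (Eq.trans ?_ (mixedBimodule_smul φ a (AlgHom.op φ a') (φ x)).symm)
          exact (map_mul φ _ _).trans (congrArg (· * _) (map_mul φ _ _)) }

/-- The morphism `b ⊗ a ↦ φ(a) b`. -/
noncomputable def extendedBimoduleHom :
    (partialBaseChange k (AlgHom.op φ) A).obj ((swap k A Aᵐᵒᵖ).obj (regularBimodule k A)) ⟶
      mixedBimodule φ :=
  (partialBaseChange k (AlgHom.op φ) A).map (bimoduleHom φ) ≫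
    partialBaseChangeCounit (AlgHom.op φ) (mixedBimodule φ)

lemma extendedBimoduleHom_mk (b : Bᵐᵒᵖ) (a : A) :
    extendedBimoduleHom φ (partialBaseChangeMk (AlgHom.op φ)
      ((swap k A Aᵐᵒᵖ).obj (regularBimodule k A)) b a) =
        (show mixedBimodule φ from φ a * b.unop) := by
  refine (mixedBimodule_smul φ 1 b (φ a)).trans ?_
  have : φ 1 * φ a * b.unop = φ a * b.unop := by rw [map_one, one_mul]
  exact this

section

variable {R S T : Type u} [Ring R] [Ring S] [Ring T] [Algebra k R] [Algebra k S] [Algebra k T]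
  (g : R →ₐ[k] S)

lemma partialBaseChange_induction {X : ModuleCat.{u} (R ⊗[k] T)}
    {p : PartialBaseChange g X → Prop} (h : ∀ s x, p (partialBaseChangeMk g X s x))
    (h' : ∀ y z, p y → p z → p (y + z)) (y : PartialBaseChange g X) : p y := by
  obtain ⟨y, rfl⟩ := Submodule.Quotient.mk_surjective _ y
  induction y with
  | zero =>
    refine (congrArg p ?_).mpr (h 0 0)
    exact (congrArg (balancedRel (g : R →+* S) ((leftPart k R T).obj X)).mkQ
      (TensorProduct.zero_tmul _ (0 : (leftPart k R T).obj X)).symm)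
  | tmul s x => exact h s x
  | add y z hy hz => exact h' _ _ hy hz

lemma partialBaseChangeMk_add_left (X : ModuleCat.{u} (R ⊗[k] T)) (s s' : S) (x : X) :
    partialBaseChangeMk g X (s + s') x =
      partialBaseChangeMk g X s x + partialBaseChangeMk g X s' x :=
  (congrArg (balancedRel (g : R →+* S) ((leftPart k R T).obj X)).mkQ
    (TensorProduct.add_tmul (N := (leftPart k R T).obj X) s s' x)).trans (map_add _ _ _)

end

instance : IsIso (extendedBimoduleHom φ) := by
  let X := (swap k A Aᵐᵒᵖ).obj (regularBimodule k A)
  -- The inverse is b ↦ 1 ⊗ b; the balancing relation turns a ⊗ b into 1 ⊗ φ(a)b.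
  let n (b : B) : PartialBaseChange (AlgHom.op φ) X :=
    partialBaseChangeMk (AlgHom.op φ) X (MulOpposite.op b) (1 : A)
  have hn (b b' : B) : n (b + b') = n b + n b' := partialBaseChangeMk_add_left _ _ _ _ _
  rw [ConcreteCategory.isIso_iff_bijective]
  refine Function.bijective_iff_has_inverse.2 ⟨n, fun y => ?_, fun b => ?_⟩
  · refine partialBaseChange_induction (AlgHom.op φ) (X := X)
      (p := fun y => n (extendedBimoduleHom φ y) = y) (fun b a => ?_) (fun y z hy hz => ?_) y
    · refine (congrArg n (extendedBimoduleHom_mk φ b a)).trans ?_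
      have h₁ : MulOpposite.op (φ a * b.unop) = b * AlgHom.op φ (MulOpposite.op a) := rfl
      have h₂ : ((MulOpposite.op a : Aᵐᵒᵖ) ⊗ₜ[k] (1 : A)) • (show X from (1 : A)) =
          (show X from a) := (regularBimodule_smul (k := k) (1 : A) (MulOpposite.op a) 1).trans
            (by rw [mul_one, one_mul]; rfl)
      change partialBaseChangeMk (AlgHom.op φ) X (MulOpposite.op (φ a * b.unop)) (1 : A) = _
      rw [h₁]
      exact (partialBaseChangeMk_balanced (AlgHom.op φ) X b (MulOpposite.op a) (1 : A)).trans
        (congrArg _ h₂)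
    · refine (congrArg n (map_add (extendedBimoduleHom φ).hom y z)).trans ?_
      exact (hn _ _).trans (congrArg₂ (· + ·) hy hz)
  · refine (extendedBimoduleHom_mk φ (MulOpposite.op b) 1).trans ?_
    have h : φ 1 * (show B from b) = b := by rw [map_one, one_mul]
    exact h

/-- The left `A`-module underlying `A ⊗_A B`. -/
noncomputable def leftPartRightExtensionIso :
    (leftPart k A Bᵐᵒᵖ).obj ((rightExtension φ).obj (regularBimodule k A)) ≅ leftModule φ :=
  (leftPart k A Bᵐᵒᵖ).mapIso ((swap k Bᵐᵒᵖ A).mapIso (asIso (extendedBimoduleHom φ))) ≪≫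
    (AddEquiv.toLinearEquiv
      (M := (leftPart k A Bᵐᵒᵖ).obj ((swap k Bᵐᵒᵖ A).obj (mixedBimodule φ)))
      (M₂ := leftModule φ) (AddEquiv.refl B) fun a x => by
        refine (mixedBimodule_smul φ a (1 : Bᵐᵒᵖ) x).trans ?_
        exact mul_one (φ a * (show B from x))).toModuleIso

/-- The right action on Tor is defined by functoriality from right multiplications, so these have to
match under A ⊗_A B ≅ B. -/
lemma rightAct_leftPartRightExtensionIso_hom (b : B) :
    (rightAct k A (MulOpposite.op b)).app ((rightExtension φ).obj (regularBimodule k A)) ≫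
        (leftPartRightExtensionIso φ).hom =
      (leftPartRightExtensionIso φ).hom ≫ rightMul φ b := by
  have h := (rightAct k A (MulOpposite.op b)).naturality
    ((swap k Bᵐᵒᵖ A).map (extendedBimoduleHom φ))
  ext x
  refine (ConcreteCategory.congr_hom h x).symm.trans ?_
  refine (mixedBimodule_smul φ 1 (MulOpposite.op b) (extendedBimoduleHom φ x)).trans ?_
  have (y : B) : φ 1 * y * b = y * b := by rw [map_one, one_mul]
  exact this (extendedBimoduleHom φ x)

/-- The left `B`-module underlying the `B`-bimodule `Tor_q^A(B,B)`. -/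
noncomputable def leftPartTorBimoduleIso (q : ℕ) :
    (leftPart k B Bᵐᵒᵖ).obj (torBimodule φ q) ≅
      (torFunctor (φ : A →+* B) q).obj (leftModule φ) :=
  (AddEquiv.toLinearEquiv (M := (leftPart k B Bᵐᵒᵖ).obj (torBimodule φ q))
    (M₂ := (torFunctor (φ : A →+* B) q).obj (leftModule φ)) (AddEquiv.refl (Tor φ q))
    fun b x => by
      exact tmul_one_smul (k := k) (T := Bᵐᵒᵖ) b (show Tor φ q from x)).toModuleIso

lemma rightAct_leftPartTorBimoduleIso_hom (q : ℕ) (b : B) :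
    (rightAct k B (MulOpposite.op b)).app (torBimodule φ q) ≫ (leftPartTorBimoduleIso φ q).hom =
      (leftPartTorBimoduleIso φ q).hom ≫ (torFunctor (φ : A →+* B) q).map (rightMul φ b) := by
  ext x
  exact one_tmul_smul (k := k) (S := B) (MulOpposite.op b) (show Tor φ q from x)

end RegularBimodule

/-! ### Homology of a one-sided extension as Tor, with its second action. -/

section HomologyComparison

lemma comp_trans_hom_comm {C : Type*} [Category* C] {X Y Z W : C} (e₁ : X ≅ Y) (e₂ : Y ≅ Z)
    (e₃ : W ≅ Z) {x : X ⟶ X} {y : Y ⟶ Y} {z : Z ⟶ Z} {w : W ⟶ W}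
    (h₁ : x ≫ e₁.hom = e₁.hom ≫ y) (h₂ : y ≫ e₂.hom = e₂.hom ≫ z)
    (h₃ : w ≫ e₃.hom = e₃.hom ≫ z) :
    x ≫ (e₁ ≪≫ e₂ ≪≫ e₃.symm).hom = (e₁ ≪≫ e₂ ≪≫ e₃.symm).hom ≫ w := by
  have h₄ : z ≫ e₃.inv = e₃.inv ≫ w := by
    rw [Iso.comp_inv_eq, Category.assoc, h₃, Iso.inv_hom_id_assoc]
  simp [reassoc_of% h₁, reassoc_of% h₂, h₄]

variable {k : Type u} [Field k] {R S T : Type u} [Ring R] [Ring S] [Ring T] [Algebra k R]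
  [Algebra k S] [Algebra k T] (g : R →ₐ[k] S) {X : ModuleCat.{u} (R ⊗[k] T)}
  {K : ChainComplex (ModuleCat.{u} (R ⊗[k] T)) ℕ} (π : K ⟶ (ChainComplex.single₀ _).obj X)
  [QuasiIso π] (hK : ∀ i, Projective ((leftPart k R T).obj (K.X i)))

/-- The resolution of the underlying `R`-module which is given by a resolution of an
`R ⊗ T`-module. -/
noncomputable def leftPartResolution : ProjectiveResolution ((leftPart k R T).obj X) where
  complex := ((leftPart k R T).mapHomologicalComplex _).obj K
  projective := hK
  π := ((leftPart k R T).mapHomologicalComplex _).map π ≫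
    (HomologicalComplex.singleMapHomologicalComplex (leftPart k R T) (.down ℕ) 0).hom.app X

lemma leftPartResolution_π_f_zero :
    (leftPartResolution π hK).π.f 0 = (leftPart k R T).map (π.f 0) := by
  refine (congrArg ((leftPart k R T).map (π.f 0) ≫ ·)
    (HomologicalComplex.singleMapHomologicalComplex_hom_app_self _ _ _ _)).trans ?_
  rw [ChainComplex.single₀ObjXSelf, ChainComplex.single₀ObjXSelf]
  simp

/-- The homology of `S ⊗_R K` for a resolution `K` of an `R ⊗ T`-module, as an `S`-module. -/
noncomputable def leftPartHomologyIso (q : ℕ) : (leftPart k S T).obj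
    ((((partialBaseChange k g T).mapHomologicalComplex _).obj K).homology q) ≅
      (torFunctor (g : R →+* S) q).obj ((leftPart k R T).obj X) :=
  (ShortComplex.mapHomologyIso ((((partialBaseChange k g T).mapHomologicalComplex _).obj K).sc q)
      (leftPart k S T)).symm ≪≫
    HomologicalComplex.homologyMapIso
      ((NatIso.mapHomologicalComplex (partialBaseChangeLeftPart k g T) (.down ℕ)).app K) q ≪≫
    ((leftPartResolution π hK).isoLeftDerivedObj (baseChange (g : R →+* S)) q).symm

/-- The action of t on K is a chain map over R lifting its action on X; by definition of derived
functors it induces on homology the map given by functoriality of Tor. -/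
lemma rightAct_leftPartHomologyIso_hom (q : ℕ) (t : T) :
    (rightAct k S t).app ((((partialBaseChange k g T).mapHomologicalComplex _).obj K).homology q) ≫
        (leftPartHomologyIso g π hK q).hom =
      (leftPartHomologyIso g π hK q).hom ≫
        (torFunctor (g : R →+* S) q).map ((rightAct k R t).app X) := by
  have h₁ := (rightAct k S t).app_homology
    ((((partialBaseChange k g T).mapHomologicalComplex (.down ℕ)).obj K).sc q)
  have h₂ : (rightAct k R t).app (K.X 0) ≫ (leftPartResolution π hK).π.f 0 =
      (leftPartResolution π hK).π.f 0 ≫ (rightAct k R t).app X := by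
    rw [leftPartResolution_π_f_zero]
    exact ((rightAct k R t).naturality (π.f 0)).symm
  have h₃ : (NatTrans.mapHomologicalComplex (rightAct k S t) (.down ℕ)).app
      (((partialBaseChange k g T).mapHomologicalComplex _).obj K) ≫
      (NatTrans.mapHomologicalComplex (partialBaseChangeLeftPart k g T).hom (.down ℕ)).app K =
      (NatTrans.mapHomologicalComplex (partialBaseChangeLeftPart k g T).hom (.down ℕ)).app K ≫
        ((baseChange (g : R →+* S)).mapHomologicalComplex _).map
          ((NatTrans.mapHomologicalComplex (rightAct k R t) (.down ℕ)).app K) := by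
    ext i : 1
    exact rightAct_partialBaseChangeLeftPart_hom k g T t (K.X i)
  have h₄ := congrArg (fun f => HomologicalComplex.homologyMap f q) h₃
  refine comp_trans_hom_comm _ _ _ ?_ ((HomologicalComplex.homologyMap_comp _ _ q).symm.trans
    (h₄.trans (HomologicalComplex.homologyMap_comp _ _ q))) ?_
  · exact (Iso.comp_inv_eq _).2 ((h₁.trans (Category.assoc _ _ _).symm))
  · exact (leftPartResolution π hK).isoLeftDerivedObj_hom_naturality _ _ _ h₂ _ q

end HomologyComparison

section

variable {k : Type u} [Field k] {A B : Type u} [Ring A] [Ring B] [Algebra k A] [Algebra k B]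
  (φ : A →ₐ[k] B)

/-- P ⊗_A B resolves the left A-module B by projectives, so the homology is Tor as a left B-module;
the isomorphism upgrades to bimodules because it commutes with the right actions. -/
theorem nonempty_homology_envelopingExtension_iso
    (P : ProjectiveResolution (regularBimodule k A)) (q : ℕ) :
    Nonempty ((((envelopingExtension φ).mapHomologicalComplex (.down ℕ)).obj P.complex).homology q ≅
      torBimodule φ q) := by
  have := quasiIso_rightExtension_map φ P
  let K := ((rightExtension φ).mapHomologicalComplex (.down ℕ)).obj P.complex
  let π : K ⟶ (ChainComplex.single₀ _).obj ((rightExtension φ).obj (regularBimodule k A)) :=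
    ((rightExtension φ).mapHomologicalComplex _).map P.π ≫
      (HomologicalComplex.singleMapHomologicalComplex (rightExtension φ) (.down ℕ) 0).hom.app _
  have : QuasiIso π := inferInstance
  have hK (i : ℕ) : Projective ((leftPart k A Bᵐᵒᵖ).obj (K.X i)) :=
    projective_leftPart_rightExtension_obj φ (P.complex.X i)
  let e := leftPartHomologyIso φ π hK q ≪≫
    (torFunctor (φ : A →+* B) q).mapIso (leftPartRightExtensionIso φ) ≪≫
      (leftPartTorBimoduleIso φ q).symm
  refine ⟨isoOfLeftPart e fun t => ?_⟩
  obtain ⟨b, rfl⟩ := MulOpposite.op_surjective t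
  have h := congrArg (torFunctor (φ : A →+* B) q).map (rightAct_leftPartRightExtensionIso_hom φ b)
  rw [Functor.map_comp, Functor.map_comp] at h
  exact comp_trans_hom_comm _ _ _ (rightAct_leftPartHomologyIso_hom φ π hK q (MulOpposite.op b)) h
    (rightAct_leftPartTorBimoduleIso_hom φ q b)

end

end HochSS

theorem mainTheorem1 {k : Type u} [Field k] {A B : Type u} [Ring A] [Ring B]
    [Algebra k A] [Algebra k B] (φ : A →ₐ[k] B) :
    ∃ (E : ModuleCat.{u} (B ⊗[k] Bᵐᵒᵖ) ⥤ E₂CohomologicalSpectralSequenceNat (ModuleCat.{u} k))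
      (e : ∀ p q : ℕ, E ⋙ SpectralSequence.pageFunctor _ _ 2 2 ⋙ HomologicalComplex.eval _ _ (p, q)
        ≅ HochSS.extFunctor k (HochSS.torBimodule φ q) p)
      (O : ∀ q : ℕ, Abelian.Ext (HochSS.torBimodule φ q) (HochSS.torBimodule φ (q + 1)) 2),
      Nonempty (HochSS.Convergence E
        (fun n => HochSS.pullback φ ⋙ HochSS.hochschildCohomology k A n)) ∧
      ∀ (M : ModuleCat.{u} (B ⊗[k] Bᵐᵒᵖ)) (p q : ℕ)
        (ζ : Abelian.Ext (HochSS.torBimodule φ (q + 1)) M p),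
        ((e (p + 2) q).hom.app M).hom
            ((((E.obj M).page 2).d (p, q + 1) (p + 2, q)).hom
              (((e p (q + 1)).inv.app M).hom ζ)) =
          (-1 : k) ^ p • (O q).comp ζ (add_comm 2 p) := by
  let := HasDerivedCategory.standard (ModuleCat.{u} (A ⊗[k] Aᵐᵒᵖ))
  let := HasDerivedCategory.standard (ModuleCat.{u} (B ⊗[k] Bᵐᵒᵖ))
  let P := projectiveResolution (HochSS.regularBimodule k A)
  let adj := HochSS.envelopingAdjunction φ
  let X := HochSS.leftDerivedObj (HochSS.envelopingExtension φ) P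
  have : HochSS.HomSmall.{u} (DerivedCategory.singleFunctor _ 0) X :=
    HochSS.homSmall_leftDerivedObj k adj P
  -- The q-th graded piece of X is Tor_q^A(B, B)[q].
  have b (q : ℕ) := (HochSS.nonempty_homology_envelopingExtension_iso φ P q).elim
    (HochSS.nonempty_heartPiece_leftDerivedObj_iso (HochSS.envelopingExtension φ) P q)
  obtain ⟨e, O, h⟩ := HochSS.exists_iso_ext_and_differential (k := k) X
    (HochSS.torBimodule φ) (fun q => (b q).some)
  exact ⟨_, e, O, ⟨HochSS.spectralObjectConvergence (HochSS.truncationSpectralObject k X)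
    fun n => HochSS.extFunctorIsoOfAdjunction k adj P n⟩, h⟩
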